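/- Let $p>1$, $T>0$, $\Omega=(-T,T)$, and let $W^{1,p}_0(\Omega)$ be the completion of $C_c^\infty(\Omega)$ in the norm $\|u'\|_{L^p(\Omega)}$. Let $\mathscr H$ be the set of all $H:\mathbb R\to\mathbb R$ that are non-negative, convex and positively $1$-homogeneous, i.e. of all $H_{a,b}(t)=a\,t^++b\,t^-$ with $a,b\ge 0$, where $t^\pm=\max\{\pm t,0\}$, and let $\|H\|=\max_{|x|=1}H(x)$, so that $\|H_{a,b}\|=\max\{a,b\}$. For $H\in\mathscr H$ let $-\Delta_p^Hu=-\big(H(u')^{p-1}H'(u')\big)'$, understood weakly as an operator from $W_0^{1,p}(\Omega)$ to its dual, let $-\Delta_p=-\Delta_p^{|\cdot|}$, and put $$\lambda_1(-\Delta_p^H):=\lambda_p^H(\Omega):=\inf\Big\{\int_\Omega H(u')^p\,dt:\ u\in W_0^{1,p}(\Omega),\ \|u\|_{L^p(\Omega)}=1\Big\},\qquad \lambda_{1,p}(-T,T):=\lambda_p^{|\cdot|}(\Omega).$$ Let $\mathcal E(\Omega)$ be the set of the operators $-\Delta_p^H$, $H\in\mathscr H\setminus\{0\}$, for which $\lambda_p^H(\Omega)$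 is a fundamental frequency: there is a non-zero $u\in W_0^{1,p}(\Omega)$ such that $H'(u')$ is well defined almost everywhere and measurable and $$\int_\Omega H(u')^{p-1}H'(u')\,\varphi'\,dt=\lambda_p^H(\Omega)\int_\Omega|u|^{p-2}u\,\varphi\,dt\qquad\text{for all }\varphi\in W_0^{1,p}(\Omega).$$ Let $\Lambda^{\max}(-T,T)$ and $\Lambda^{\min}(-T,T)$ be the supremum and the infimum of $\lambda_1(-\Delta_p^H)$ over all $-\Delta_p^H\in\mathcal E(\Omega)$ with $\|H\|=1$ (a non-empty bounded set of values). Then $$\Lambda^{\min}(-T,T)\max\{a,b\}^p\le\lambda_1(-\Delta_p^{H_{a,b}})\le\Lambda^{\max}(-T,T)\max\{a,b\}^p$$ for every $-\Delta_p^{H_{a,b}}\in\mathcal E(\Omega)$, where $$\Lambda^{\max}(-T,T)=\lambda_{1,p}(-T,T),\qquad \Lambda^{\min}(-T,T)=\frac1{2^p}\,\lambda_{1,p}(-T,T).$$ Moreover, among all operators $-\Delta_p^{H_{a,b}}$ with $a,b\ge0$ not both zero, those that give equality on the right are exactly the positive multiples of $-\Delta_p$, and these all belong to $\mathcal E(\Omega)$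 (no multiple of $-\Delta_p$ by a real number $c\le 0$ is of the form $-\Delta_p^H$ with $H\in\mathscr H\setminus\{0\}$); those that give equality on the left are exactly the operators $-\Delta_p^{H_{a,0}}$ and $-\Delta_p^{H_{0,b}}$ with $a,b>0$, and none of these belongs to $\mathcal E(\Omega)$. -/

import Mathlib

open MeasureTheory Set Filter Topology

noncomputable section

/-- Smooth functions with compact support in `Ω`. -/
def IsTestFun (Ω : Set ℝ) (φ : ℝ → ℝ) : Prop :=
  ContDiff ℝ ((⊤ : ℕ∞) : WithTop ℕ∞) φ ∧ HasCompactSupport φ ∧ tsupport φ ⊆ Ω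

/-- The Sobolev space `W₀^{1,p}(Ω)`, `Ω ⊆ ℝ`: a function `toFun ∈ L^p(Ω)` together with its
weak derivative `grad ∈ L^p(Ω)`, which is a limit of test functions in the Sobolev norm.
(Values outside `Ω` and on null sets play no role.) -/
structure W0 (Ω : Set ℝ) (p : ℝ) where
  toFun : ℝ → ℝ
  grad : ℝ → ℝ
  memLp_toFun : MemLp toFun (ENNReal.ofReal p) (volume.restrict Ω)
  memLp_grad : MemLp grad (ENNReal.ofReal p) (volume.restrict Ω)
  weakDeriv : ∀ φ : ℝ → ℝ, IsTestFun Ω φ →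
    ∫ t in Ω, toFun t * deriv φ t = - ∫ t in Ω, grad t * φ t
  approx : ∃ φ : ℕ → ℝ → ℝ, (∀ n, IsTestFun Ω (φ n)) ∧
    Tendsto (fun n => eLpNorm (fun t => toFun t - φ n t) (ENNReal.ofReal p) (volume.restrict Ω))
      atTop (𝓝 0) ∧
    Tendsto (fun n => eLpNorm (fun t => grad t - deriv (φ n) t) (ENNReal.ofReal p)
      (volume.restrict Ω)) atTop (𝓝 0)

/-- The `L^p(Ω)` norm. -/
def lpNormOn (Ω : Set ℝ) (p : ℝ) (u : ℝ → ℝ) : ℝ :=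
  (∫ t in Ω, |u t| ^ p) ^ (1 / p)

/-- Asymmetric anisotropies (asymmetric seminorms) on the line. -/
structure IsAnisotropy (H : ℝ → ℝ) : Prop where
  nonneg : ∀ x, 0 ≤ H x
  convex : ConvexOn ℝ univ H
  homog : ∀ t x, 0 < t → H (t * x) = t * H x

/-- `H_{a,b}(t) = a t⁺ + b t⁻`. -/
def Hab (a b : ℝ) (t : ℝ) : ℝ := a * max t 0 + b * max (-t) 0

/-- `‖H‖`, the maximum of `H` on the unit sphere `{-1, 1}` of `ℝ`. -/
def anisoNorm (H : ℝ → ℝ) : ℝ := sSup (H '' Metric.sphere (0 : ℝ) 1)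

/-- The anisotropic energy of `u`. -/
def energy (Ω : Set ℝ) (p : ℝ) (H : ℝ → ℝ) (u : W0 Ω p) : ℝ :=
  ∫ t in Ω, (H (u.grad t)) ^ p

/-- The least energy level `λ_p^H(Ω)` on the unit sphere of `L^p(Ω)`; this is also what is meant
by `λ₁(-Δ_p^H)`. -/
def level (Ω : Set ℝ) (p : ℝ) (H : ℝ → ℝ) : ℝ :=
  sInf {e | ∃ u : W0 Ω p, lpNormOn Ω p u.toFun = 1 ∧ e = energy Ω p H u}

/-- Operators from `W₀^{1,p}(Ω)` to functionals on it, in weak form. -/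
abbrev WeakOperator (Ω : Set ℝ) (p : ℝ) : Type := W0 Ω p → W0 Ω p → ℝ

/-- The operator `-Δ_p^H u = -(H(u')^{p-1} H'(u'))'` in weak form. Where `H` is not differentiable
one has `H = 0` for an anisotropy on the line, so the integrand vanishes there. -/
def negLap (Ω : Set ℝ) (p : ℝ) (H : ℝ → ℝ) : WeakOperator Ω p :=
  fun u φ => ∫ t in Ω, (H (u.grad t)) ^ (p - 1) * deriv H (u.grad t) * φ.grad t

/-- The `p`-Laplace operator `-Δ_p`, which is `-Δ_p^H` with `H = |·|`. -/
def negPLap (Ω : Set ℝ) (p : ℝ) : WeakOperator Ω p := negLap Ω p (fun t => |t|)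

/-- `λ_{1,p}(Ω)`, the first Dirichlet eigenvalue of `-Δ_p`. -/
def lambda1p (Ω : Set ℝ) (p : ℝ) : ℝ := level Ω p (fun t => |t|)

/-- `λ_p^H(Ω)` is a fundamental frequency: there is a non-zero `u ∈ W₀^{1,p}(Ω)` for which `H'(u')`
is well defined a.e. and measurable, and `-Δ_p^H u = λ_p^H(Ω) |u|^{p-2} u` weakly. -/
def IsFundamentalFrequency (Ω : Set ℝ) (p : ℝ) (H : ℝ → ℝ) : Prop :=
  ∃ u : W0 Ω p, ¬ (u.toFun =ᵐ[volume.restrict Ω] 0) ∧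
    (∀ᵐ t ∂(volume.restrict Ω), DifferentiableAt ℝ H (u.grad t)) ∧
    AEMeasurable (fun t => deriv H (u.grad t)) (volume.restrict Ω) ∧
    ∀ φ : W0 Ω p, negLap Ω p H u φ =
      level Ω p H * ∫ t in Ω, |u.toFun t| ^ (p - 2) * u.toFun t * φ.toFun t

/-- The class `𝓔(Ω)` of operators `-Δ_p^H`, `H ≠ 0`, whose level is a fundamental frequency. -/
def EllClass (Ω : Set ℝ) (p : ℝ) : Set (WeakOperator Ω p) :=
  {L | ∃ H : ℝ → ℝ, IsAnisotropy H ∧ H ≠ 0 ∧ IsFundamentalFrequency Ω p H ∧ L = negLap Ω p H}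

/-- The levels `λ₁(-Δ_p^H)` of the operators of `𝓔(Ω)` with `‖H‖ = 1`. -/
def normalizedLevels (Ω : Set ℝ) (p : ℝ) : Set ℝ :=
  {l | ∃ H : ℝ → ℝ, IsAnisotropy H ∧ negLap Ω p H ∈ EllClass Ω p ∧ anisoNorm H = 1 ∧
    l = level Ω p H}

/-- The optimal upper constant `Λ^max(Ω)`. -/
def LambdaMax (Ω : Set ℝ) (p : ℝ) : ℝ := sSup (normalizedLevels Ω p)

/-- The optimal lower constant `Λ^min(Ω)`. -/
def LambdaMin (Ω : Set ℝ) (p : ℝ) : ℝ := sInf (normalizedLevels Ω p)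

end

/-! ### Stability of energies and primitives under `L^p` convergence -/

noncomputable section

/-! Everything follows from one formula: the level of `H_{a,b}` on `(-T,T)` is `((a+b)/2)^p` times
the first eigenvalue of the `p`-Laplacian (`level_Hab_eq`). Since `max a b ≤ a + b ≤ 2 max a b` for
`a, b ≥ 0`, with equality on the right iff `a = b` and on the left iff `ab = 0`, the bounds and
equality cases are then arithmetic.

The formula comes from an explicit ground state for `a, b > 0`. A quarter period of the `p`-sine,
run at speed `κ/a` from `-T`, is glued to a reflected one run at speed `κ/b` from `T`. The pieces
meet at their maxima exactly when `κ = L(a+b)/(2T)`, and the result solves the Euler–Lagrange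
equation with eigenvalue `(p-1)κ^p` (`IsPSine.exists_groundState`). That this eigenvalue is the
least energy is Picone's inequality against the ground state (`IsPSine.picone_testFun`), applied to
the positive and negative parts of test functions and extended by density (`IsPSine.poincare`).
Letting `a` or `b` tend to `0` gives the formula for all `a, b ≥ 0`.

If `a = 0` or `b = 0` there is no eigenfunction (`ae_eq_zero_of_degenerate_flux`). Up to replacing
`u` by `-u`, the flux is a multiple of `(u'^+)^{p-1}`, hence a non-negative differentiable function
with derivative `-l|u|^{p-2}u`. Where `u ≠ 0` this flux cannot vanish, so `u` is strictly increasing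
there, and `u` has neither a non-zero maximum nor a non-zero minimum.

Finally, the operator determines `(a, b)` (`negLap_Hab_injective`), so membership in the class, a
property of operators, is equivalent to `a, b > 0` (`negLap_Hab_mem_EllClass`). -/

lemma one_le_ofReal_of_one_lt {p : ℝ} (hp : 1 < p) : 1 ≤ ENNReal.ofReal p := by
  simpa using ENNReal.ofReal_le_ofReal hp.le

/-- The Lipschitz bound gives `‖K ∘ F n - K ∘ f‖_p ≤ ‖F n - f‖_p`, so the norms of `K ∘ F n`
converge, and so do their `p`-th powers. It is applied with `K` the absolute value and the positive
and negative parts. -/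
lemma tendsto_integral_rpow_comp {μ : Measure ℝ} {p : ℝ} (hp : 1 < p) {K : ℝ → ℝ}
    (hK : LipschitzWith 1 K) (hK0 : K 0 = 0) (hKn : ∀ x, 0 ≤ K x) {f : ℝ → ℝ} {F : ℕ → ℝ → ℝ}
    (hf : MemLp f (ENNReal.ofReal p) μ) (hF : ∀ n, MemLp (F n) (ENNReal.ofReal p) μ)
    (h : Tendsto (fun n => eLpNorm (fun t => f t - F n t) (ENNReal.ofReal p) μ) atTop (𝓝 0)) :
    Tendsto (fun n => ∫ t, K (F n t) ^ p ∂μ) atTop (𝓝 (∫ t, K (f t) ^ p ∂μ)) := by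
  have hp0 : 0 < p := by linarith
  have : Fact (1 ≤ ENNReal.ofReal p) := ⟨one_le_ofReal_of_one_lt hp⟩
  have hKf : MemLp (K ∘ f) (ENNReal.ofReal p) μ := hK.comp_memLp hK0 hf
  have hKF : ∀ n, MemLp (K ∘ F n) (ENNReal.ofReal p) μ := fun n => hK.comp_memLp hK0 (hF n)
  have h1 : Tendsto (fun n => eLpNorm (K ∘ F n - K ∘ f) (ENNReal.ofReal p) μ) atTop (𝓝 0) := by
    refine tendsto_of_tendsto_of_tendsto_of_le_of_le tendsto_const_nhds h (fun _ => zero_le)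
      fun n => eLpNorm_mono fun t => ?_
    have := hK.dist_le_mul (F n t) (f t)
    simpa [Real.dist_eq, abs_sub_comm (F n t)] using this
  have h2 := ((Lp.tendsto_Lp_iff_tendsto_eLpNorm'' _ hKF _ hKf).2 h1).norm
  simp only [Lp.norm_toLp] at h2
  have key : ∀ g : ℝ → ℝ, MemLp (K ∘ g) (ENNReal.ofReal p) μ →
      (eLpNorm (K ∘ g) (ENNReal.ofReal p) μ).toReal ^ p = ∫ t, K (g t) ^ p ∂μ := by
    intro g hg
    rw [hg.eLpNorm_eq_integral_rpow_norm (by simpa using hp0) (by simp),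
      ENNReal.toReal_ofReal (by positivity), ENNReal.toReal_ofReal hp0.le,
      ← Real.rpow_mul (by positivity), inv_mul_cancel₀ hp0.ne', Real.rpow_one]
    simp [abs_of_nonneg (hKn _)]
  have h3 := h2.rpow_const (p := p) (Or.inr hp0.le)
  simpa only [key _ hKf, fun n => key _ (hKF n)] using h3

lemma intervalIntegrable_of_integrableOn_Ioo {f : ℝ → ℝ} {a b : ℝ}
    (hf : IntegrableOn f (Ioo a b)) {c d : ℝ} (hc : c ∈ Icc a b) (hd : d ∈ Icc a b) :
    IntervalIntegrable f volume c d := by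
  have h : IntegrableOn f (Icc a b) :=
    (integrableOn_Icc_iff_integrableOn_Ioo (by simp) (by simp)).2 hf
  have h2 : IntervalIntegrable f volume a b :=
    (intervalIntegrable_iff_integrableOn_Icc_of_le (hc.1.trans hc.2)).2 h
  refine h2.mono_set ?_
  rw [uIcc_of_le (hc.1.trans hc.2)]
  exact uIcc_subset_Icc hc hd

lemma intervalIntegral_eq_setIntegral_Ioo {f : ℝ → ℝ} {a b : ℝ} (h : a ≤ b) :
    ∫ t in a..b, f t = ∫ t in Ioo a b, f t := by
  rw [intervalIntegral.integral_of_le h, integral_Ioc_eq_integral_Ioo]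

/-- Primitives are controlled uniformly by the `L^p` norm of the integrand. -/
lemma exists_enorm_primitive_le {p a b : ℝ} (hp : 1 < p) :
    ∃ C : ENNReal, C ≠ ⊤ ∧ ∀ f : ℝ → ℝ,
      MemLp f (ENNReal.ofReal p) (volume.restrict (Ioo a b)) → ∀ t ∈ Icc a b,
      ‖∫ s in a..t, f s‖ₑ ≤ C * eLpNorm f (ENNReal.ofReal p) (volume.restrict (Ioo a b)) := by
  have hp0 : 0 < p := by linarith
  -- Hölder's constant `|(a,b)|^{1 - 1/p}`.
  refine ⟨(volume.restrict (Ioo a b)) univ ^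
    (1 / (1 : ENNReal).toReal - 1 / (ENNReal.ofReal p).toReal), ?_, ?_⟩
  · refine ENNReal.rpow_ne_top_of_nonneg ?_ (by simp)
    rw [ENNReal.toReal_ofReal hp0.le]
    simp only [ENNReal.toReal_one, sub_nonneg, div_one]
    rw [div_le_one hp0]; exact hp.le
  · intro f hf t ht
    calc ‖∫ s in a..t, f s‖ₑ ≤ ∫⁻ s in Ioc a t, ‖f s‖ₑ := by
          rw [intervalIntegral.integral_of_le ht.1]
          exact enorm_integral_le_lintegral_enorm _
      _ ≤ ∫⁻ s in Ioo a b, ‖f s‖ₑ := by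
          rw [setLIntegral_congr Ioo_ae_eq_Ioc]
          exact lintegral_mono_set (Ioc_subset_Ioc_right ht.2)
      _ = eLpNorm f 1 (volume.restrict (Ioo a b)) := (eLpNorm_one_eq_lintegral_enorm).symm
      _ ≤ _ := by
          rw [mul_comm]
          exact eLpNorm_le_eLpNorm_mul_rpow_measure_univ (one_le_ofReal_of_one_lt hp)
            hf.aestronglyMeasurable

/-! ### Continuous representatives and integration by parts -/

section TestFunctions

variable {T p : ℝ}

lemma IsTestFun.memLp {Ω : Set ℝ} {φ : ℝ → ℝ} (h : IsTestFun Ω φ) (q : ENNReal) :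
    MemLp φ q (volume.restrict Ω) :=
  (h.1.continuous.memLp_of_hasCompactSupport h.2.1).restrict _

lemma IsTestFun.continuous_deriv {Ω : Set ℝ} {φ : ℝ → ℝ} (h : IsTestFun Ω φ) :
    Continuous (deriv φ) := h.1.continuous_deriv (by simp)

lemma IsTestFun.memLp_deriv {Ω : Set ℝ} {φ : ℝ → ℝ} (h : IsTestFun Ω φ) (q : ENNReal) :
    MemLp (deriv φ) q (volume.restrict Ω) :=
  (h.continuous_deriv.memLp_of_hasCompactSupport h.2.1.deriv).restrict _

lemma IsTestFun.hasDerivAt {Ω : Set ℝ} {φ : ℝ → ℝ} (h : IsTestFun Ω φ) (t : ℝ) :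
    HasDerivAt φ (deriv φ t) t :=
  (h.1.differentiable (by simp) t).hasDerivAt

lemma IsTestFun.eq_zero_of_notMem {Ω : Set ℝ} {φ : ℝ → ℝ} (h : IsTestFun Ω φ) {t : ℝ}
    (ht : t ∉ Ω) : φ t = 0 :=
  image_eq_zero_of_notMem_tsupport fun h' => ht (h.2.2 h')

lemma IsTestFun.eq_primitive {φ : ℝ → ℝ} (h : IsTestFun (Ioo (-T) T) φ) (t : ℝ) :
    φ t = ∫ s in (-T)..t, deriv φ s := by
  rw [intervalIntegral.integral_eq_sub_of_hasDerivAt (fun x _ => h.hasDerivAt x)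
    (h.continuous_deriv.intervalIntegrable _ _), h.eq_zero_of_notMem (t := -T) (by simp), sub_zero]

lemma W0.integrableOn_grad (hp : 1 < p) (u : W0 (Ioo (-T) T) p) :
    IntegrableOn u.grad (Ioo (-T) T) :=
  u.memLp_grad.integrable (one_le_ofReal_of_one_lt hp)

/-- The continuous representative of an element of `W₀^{1,p}`. -/
def W0.rep (u : W0 (Ioo (-T) T) p) (t : ℝ) : ℝ := ∫ s in (-T)..t, u.grad s

lemma tendsto_primitive (hp : 1 < p) (hT : 0 < T) {g : ℝ → ℝ} {G : ℕ → ℝ → ℝ}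
    (hg : MemLp g (ENNReal.ofReal p) (volume.restrict (Ioo (-T) T)))
    (hG : ∀ n, MemLp (G n) (ENNReal.ofReal p) (volume.restrict (Ioo (-T) T)))
    (h : Tendsto (fun n => eLpNorm (fun t => g t - G n t) (ENNReal.ofReal p)
      (volume.restrict (Ioo (-T) T))) atTop (𝓝 0)) {t : ℝ} (ht : t ∈ Icc (-T) T) :
    Tendsto (fun n => ∫ s in (-T)..t, G n s) atTop (𝓝 (∫ s in (-T)..t, g s)) := by
  have h1 := one_le_ofReal_of_one_lt hp
  have hl : (-T) ∈ Icc (-T) T := ⟨le_rfl, by linarith⟩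
  obtain ⟨C, hC, hb⟩ := exists_enorm_primitive_le (a := -T) (b := T) hp
  rw [tendsto_iff_edist_tendsto_0]
  have h2 : Tendsto (fun n => C * eLpNorm (fun t => g t - G n t) (ENNReal.ofReal p)
      (volume.restrict (Ioo (-T) T))) atTop (𝓝 0) := by
    simpa using ENNReal.Tendsto.const_mul h (Or.inr hC)
  refine tendsto_of_tendsto_of_tendsto_of_le_of_le tendsto_const_nhds h2 (fun _ => zero_le)
    fun n => ?_
  have := hb _ (hg.sub (hG n)) t ht
  rw [edist_comm, edist_eq_enorm_sub]
  simp only [Pi.sub_apply] at this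
  rwa [intervalIntegral.integral_sub
    (intervalIntegrable_of_integrableOn_Ioo (hg.integrable h1) hl ht)
    (intervalIntegrable_of_integrableOn_Ioo ((hG n).integrable h1) hl ht)] at this

/-- Test functions vanish at `T` and are the primitives of their derivatives, and the value of a
primitive at `T` passes to the limit. Equivalently, gradients have mean zero. -/
lemma W0.rep_right (hp : 1 < p) (hT : 0 < T) (u : W0 (Ioo (-T) T) p) : u.rep T = 0 := by
  obtain ⟨φ, hφ, -, h2⟩ := u.approx
  have h3 := tendsto_primitive hp hT u.memLp_grad (fun n => (hφ n).memLp_deriv _) h2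
    (t := T) ⟨by linarith, le_rfl⟩
  simp only [← fun n => (hφ n).eq_primitive T,
    fun n => (hφ n).eq_zero_of_notMem (t := T) (by simp)] at h3
  exact tendsto_nhds_unique h3 tendsto_const_nhds

lemma W0.rep_left (u : W0 (Ioo (-T) T) p) : u.rep (-T) = 0 := by simp [W0.rep]

/-- The approximating test functions converge to `u.toFun` almost everywhere along a subsequence,
and to `u.rep` at every point, because they are primitives of their derivatives. -/
lemma W0.ae_eq_rep (hp : 1 < p) (hT : 0 < T) (u : W0 (Ioo (-T) T) p) :
    u.toFun =ᵐ[volume.restrict (Ioo (-T) T)] u.rep := by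
  obtain ⟨φ, hφ, h1, h2⟩ := u.approx
  have h3 : TendstoInMeasure (volume.restrict (Ioo (-T) T)) φ atTop u.toFun := by
    refine tendstoInMeasure_of_tendsto_eLpNorm (p := ENNReal.ofReal p) ?_
      (fun n => ((hφ n).memLp 1).aestronglyMeasurable) u.memLp_toFun.aestronglyMeasurable ?_
    · simp; linarith
    · simp_rw [eLpNorm_sub_comm _ u.toFun]
      exact h1
  obtain ⟨ns, hns, h4⟩ := h3.exists_seq_tendsto_ae
  filter_upwards [h4, ae_restrict_mem measurableSet_Ioo] with t ht htm
  have h5 := tendsto_primitive hp hT u.memLp_grad (fun n => (hφ n).memLp_deriv _) h2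
    (t := t) (Ioo_subset_Icc_self htm)
  simp only [← fun n => (hφ n).eq_primitive t] at h5
  exact tendsto_nhds_unique ht (h5.comp hns.tendsto_atTop)

lemma continuousOn_primitive_Icc {g : ℝ → ℝ} (hT : 0 < T) (hg : IntegrableOn g (Ioo (-T) T)) :
    ContinuousOn (fun t => ∫ s in (-T)..t, g s) (Icc (-T) T) := by
  have := intervalIntegral.continuousOn_primitive_interval (f := g) (a := -T) (b := T)
    (μ := volume) (by
      rw [uIcc_of_le (by linarith)]
      exact (integrableOn_Icc_iff_integrableOn_Ioo (by simp) (by simp)).2 hg)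
  rwa [uIcc_of_le (by linarith)] at this

lemma W0.continuousOn_rep (hp : 1 < p) (hT : 0 < T) (u : W0 (Ioo (-T) T) p) :
    ContinuousOn u.rep (Icc (-T) T) :=
  continuousOn_primitive_Icc hT (u.integrableOn_grad hp)

/-- Integration by parts for primitives of integrable functions. -/
lemma integral_primitive_mul (hT : 0 < T) {m g : ℝ → ℝ} (hm : IntegrableOn m (Ioo (-T) T))
    (hg : IntegrableOn g (Ioo (-T) T)) (h0 : ∫ s in (-T)..T, g s = 0) :
    ∫ t in Ioo (-T) T, (∫ s in (-T)..t, m s) * g t =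
      - ∫ t in Ioo (-T) T, m t * ∫ s in (-T)..t, g s := by
  have hl : (-T) ∈ Icc (-T) T := ⟨le_rfl, by linarith⟩
  have hr : T ∈ Icc (-T) T := ⟨by linarith, le_rfl⟩
  have im := intervalIntegrable_of_integrableOn_Ioo hm hl hr
  have ig := intervalIntegrable_of_integrableOn_Ioo hg hl hr
  have am := im.absolutelyContinuousOnInterval_intervalIntegral (c := -T) (by simp)
  have ag := ig.absolutelyContinuousOnInterval_intervalIntegral (c := -T) (by simp)
  have := am.integral_mul_deriv_eq_deriv_mul ag
  rw [h0, intervalIntegral.integral_same] at this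
  rw [← intervalIntegral_eq_setIntegral_Ioo (by linarith),
    ← intervalIntegral_eq_setIntegral_Ioo (by linarith)]
  have e1 : ∫ t in (-T)..T, (∫ s in (-T)..t, m s) * deriv (fun x => ∫ s in (-T)..x, g s) t
      = ∫ t in (-T)..T, (∫ s in (-T)..t, m s) * g t := by
    refine intervalIntegral.integral_congr_ae ?_
    filter_upwards [ig.ae_hasDerivAt_integral] with t ht htm
    rw [(ht (uIoc_subset_uIcc htm) (-T) (by simp)).deriv]
  have e2 : ∫ t in (-T)..T, deriv (fun x => ∫ s in (-T)..x, m s) t * (∫ s in (-T)..t, g s)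
      = ∫ t in (-T)..T, m t * ∫ s in (-T)..t, g s := by
    refine intervalIntegral.integral_congr_ae ?_
    filter_upwards [im.ae_hasDerivAt_integral] with t ht htm
    rw [(ht (uIoc_subset_uIcc htm) (-T) (by simp)).deriv]
  rw [e1, e2] at this
  rw [this]; ring

end TestFunctions

/-! ### Elements of the Sobolev space with a prescribed gradient -/

section Construction

variable {T p : ℝ}

/-- The primitive is zero to the left of `-R` because `g` is, and to the right of `R` because the
total integral vanishes. -/
lemma isTestFun_primitive {R : ℝ} (hRT : R < T) {g : ℝ → ℝ}
    (hg : ContDiff ℝ ((⊤ : ℕ∞) : WithTop ℕ∞) g) (hz : ∀ t, R < |t| → g t = 0)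
    (h0 : ∫ s in (-T)..T, g s = 0) :
    IsTestFun (Ioo (-T) T) (fun t => ∫ s in (-T)..t, g s) ∧
      deriv (fun t => ∫ s in (-T)..t, g s) = g := by
  have hd : ∀ t, HasDerivAt (fun t => ∫ s in (-T)..t, g s) (g t) t := fun t =>
    intervalIntegral.integral_hasDerivAt_right (hg.continuous.intervalIntegrable _ _)
      (hg.continuous.stronglyMeasurableAtFilter _ _) hg.continuous.continuousAt
  have hder : deriv (fun t => ∫ s in (-T)..t, g s) = g := funext fun t => (hd t).deriv
  have hsupp : tsupport (fun t => ∫ s in (-T)..t, g s) ⊆ Metric.closedBall 0 R := by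
    refine closure_minimal (fun t ht => ?_) Metric.isClosed_closedBall
    by_contra hcon
    rw [Metric.mem_closedBall, dist_zero_right, Real.norm_eq_abs, not_le] at hcon
    refine ht ?_
    show ∫ s in (-T)..t, g s = 0
    rcases lt_abs.1 hcon with h | h
    · rw [← intervalIntegral.integral_add_adjacent_intervals
        (hg.continuous.intervalIntegrable (-T) T) (hg.continuous.intervalIntegrable T t), h0,
        zero_add]
      refine intervalIntegral.integral_zero_ae (Eventually.of_forall fun s hs => hz s ?_)
      rw [mem_uIoc] at hs
      refine lt_of_lt_of_le ?_ (le_abs_self s)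
      rcases hs with hs | hs <;> linarith [hs.1]
    · refine intervalIntegral.integral_zero_ae (Eventually.of_forall fun s hs => hz s ?_)
      rw [mem_uIoc] at hs
      refine lt_of_lt_of_le ?_ (neg_le_abs s)
      rcases hs with hs | hs <;> linarith [hs.2]
  refine ⟨⟨?_, ?_, hsupp.trans fun t ht => ?_⟩, hder⟩
  · rw [contDiff_infty_iff_deriv, hder]
    exact ⟨fun t => (hd t).differentiableAt, hg⟩
  · exact HasCompactSupport.of_support_subset_isCompact (isCompact_closedBall 0 R)
      (subset_closure.trans hsupp)
  · rw [Metric.mem_closedBall, dist_zero_right, Real.norm_eq_abs] at ht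
    exact abs_lt.1 (ht.trans_lt hRT)

/-- Smooth functions supported away from the end points are dense in `L^p`. -/
lemma exists_smooth_near (hp : 1 < p) (hT : 0 < T) {g : ℝ → ℝ}
    (hg : MemLp g (ENNReal.ofReal p) (volume.restrict (Ioo (-T) T))) {η : ℝ} (hη : 0 < η) :
    ∃ R < T, T / 2 < R ∧ ∃ h : ℝ → ℝ, ContDiff ℝ ((⊤ : ℕ∞) : WithTop ℕ∞) h ∧
      (∀ t, R < |t| → h t = 0) ∧
      eLpNorm (g - h) (ENNReal.ofReal p) (volume.restrict (Ioo (-T) T)) ≤ ENNReal.ofReal η := by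
  have h1 := one_le_ofReal_of_one_lt hp
  obtain ⟨G, hGc, hGs, hG⟩ := hg.exist_eLpNorm_sub_le (by simp) h1 (half_pos hη)
  have hGm : MemLp G (ENNReal.ofReal p) (volume.restrict (Ioo (-T) T)) :=
    (hGs.continuous.memLp_of_hasCompactSupport hGc).restrict _
  obtain ⟨δ, hδ, hs⟩ := hGm.eLpNorm_indicator_le_of_meas h1 (by simp)
    hGs.continuous.stronglyMeasurable (half_pos hη)
  -- The layer `r < |t| < T` has measure `2(T - r) ≤ δ`, so cutting `G` off there costs at most
  -- `η/2`; the maximum with `T/2` keeps the radius positive.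
  set r := max (T / 2) (T - δ / 2) with hr
  have hr1 : T / 2 ≤ r := le_max_left _ _
  have hr2 : T - δ / 2 ≤ r := le_max_right _ _
  have hr3 : r < T := max_lt (by linarith) (by linarith)
  let χ : ContDiffBump (0 : ℝ) := ⟨r, (r + T) / 2, by linarith, by linarith⟩
  refine ⟨(r + T) / 2, by linarith, by linarith, fun t => χ t * G t, χ.contDiff.mul hGs,
    fun t ht => ?_, ?_⟩
  · simp only [χ.zero_of_le_dist (x := t) (by simpa [χ] using ht.le), zero_mul]
  have hm := hs (Metric.closedBall 0 r)ᶜ measurableSet_closedBall.compl (by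
    rw [Measure.restrict_apply measurableSet_closedBall.compl]
    calc volume ((Metric.closedBall 0 r)ᶜ ∩ Ioo (-T) T)
        ≤ volume (Ioo (-T) (-r) ∪ Ioo r T) := by
          refine measure_mono fun t ht => ?_
          simp only [mem_inter_iff, mem_compl_iff, Metric.mem_closedBall, dist_zero_right,
            Real.norm_eq_abs, not_le, mem_Ioo, lt_abs, mem_union] at ht ⊢
          rcases ht with ⟨h | h, h2, h3⟩
          · exact Or.inr ⟨h, h3⟩
          · exact Or.inl ⟨h2, by linarith⟩
      _ ≤ _ := measure_union_le _ _
      _ = ENNReal.ofReal (2 * (T - r)) := by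
          rw [Real.volume_Ioo, Real.volume_Ioo, ← ENNReal.ofReal_add (by linarith) (by linarith)]
          congr 1; ring
      _ ≤ ENNReal.ofReal δ := ENNReal.ofReal_le_ofReal (by linarith))
  have hc : Continuous fun t => χ t * G t := χ.continuous.mul hGs.continuous
  have hm2 : eLpNorm (G - fun t => χ t * G t) (ENNReal.ofReal p)
      (volume.restrict (Ioo (-T) T)) ≤ ENNReal.ofReal (η / 2) := by
    refine le_trans (eLpNorm_mono fun t => ?_) hm
    by_cases ht : t ∈ Metric.closedBall (0 : ℝ) r
    · simp [χ.one_of_mem_closedBall ht]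
    · rw [indicator_of_mem (by exact ht), Pi.sub_apply, Real.norm_eq_abs, Real.norm_eq_abs,
        show G t - χ t * G t = (1 - χ t) * G t by ring, abs_mul]
      have h2 := χ.nonneg' t
      have h3 := χ.le_one (x := t)
      exact mul_le_of_le_one_left (abs_nonneg _) (abs_le.2 ⟨by linarith, by linarith⟩)
  calc eLpNorm (g - fun t => χ t * G t) (ENNReal.ofReal p) (volume.restrict (Ioo (-T) T))
      = eLpNorm ((g - G) + (G - fun t => χ t * G t)) (ENNReal.ofReal p)
        (volume.restrict (Ioo (-T) T)) := by simp
    _ ≤ _ := eLpNorm_add_le (hg.aestronglyMeasurable.sub hGm.aestronglyMeasurable)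
        (hGm.aestronglyMeasurable.sub hc.aestronglyMeasurable) h1
    _ ≤ ENNReal.ofReal (η / 2) + ENNReal.ofReal (η / 2) := add_le_add hG hm2
    _ = ENNReal.ofReal η := by
        rw [← ENNReal.ofReal_add (by linarith) (by linarith), add_halves]

/-- A smooth approximation `h` of `g` need not have mean zero, but its integral `m` is small because
that of `g` vanishes. Subtracting `m` times a bump `β` of unit mass restores mean zero at a small
cost. -/
lemma exists_testFun_deriv_near (hp : 1 < p) (hT : 0 < T) {g : ℝ → ℝ}
    (hg : MemLp g (ENNReal.ofReal p) (volume.restrict (Ioo (-T) T)))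
    (h0 : ∫ s in (-T)..T, g s = 0) {ε : ℝ} (hε : 0 < ε) :
    ∃ φ, IsTestFun (Ioo (-T) T) φ ∧
      eLpNorm (fun t => g t - deriv φ t) (ENNReal.ofReal p) (volume.restrict (Ioo (-T) T))
        ≤ ENNReal.ofReal ε := by
  have h1 := one_le_ofReal_of_one_lt hp
  have hl : (-T) ∈ Icc (-T) T := ⟨le_rfl, by linarith⟩
  have hr : T ∈ Icc (-T) T := ⟨by linarith, le_rfl⟩
  obtain ⟨C, hC, hb⟩ := exists_enorm_primitive_le (a := -T) (b := T) hp
  let χ : ContDiffBump (0 : ℝ) := ⟨T / 4, T / 2, by linarith, by linarith⟩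
  set β : ℝ → ℝ := χ.normed volume with hβ
  have hβs : ContDiff ℝ ((⊤ : ℕ∞) : WithTop ℕ∞) β := χ.contDiff_normed
  have hβz : ∀ t, T / 2 ≤ |t| → β t = 0 := fun t ht => by
    rw [← Function.notMem_support, hβ, χ.support_normed_eq]
    simpa [χ] using ht
  have hβm : MemLp β (ENNReal.ofReal p) (volume.restrict (Ioo (-T) T)) :=
    (hβs.continuous.memLp_of_hasCompactSupport χ.hasCompactSupport_normed).restrict _
  have hβi : ∫ s in (-T)..T, β s = 1 := by
    rw [intervalIntegral_eq_setIntegral_Ioo (by linarith),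
      setIntegral_eq_integral_of_forall_compl_eq_zero, χ.integral_normed]
    intro t ht
    refine hβz t (not_lt.1 fun h => ht ?_)
    exact abs_lt.1 (h.trans (by linarith))
  set M := (C * eLpNorm β (ENNReal.ofReal p) (volume.restrict (Ioo (-T) T))).toReal with hM
  have hMtop : C * eLpNorm β (ENNReal.ofReal p) (volume.restrict (Ioo (-T) T)) ≠ ⊤ :=
    ENNReal.mul_ne_top hC hβm.eLpNorm_ne_top
  have hM0 : 0 ≤ M := ENNReal.toReal_nonneg
  -- The correction by `m β` costs at most `M` times the error of `h`, hence the accuracy `ε / (1 +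
  -- M)`.
  obtain ⟨R, hRT, hR, h, hs, hz, hn⟩ := exists_smooth_near hp hT hg
    (η := ε / (1 + M)) (by positivity)
  have hhm : MemLp h (ENNReal.ofReal p) (volume.restrict (Ioo (-T) T)) :=
    (hs.continuous.memLp_of_hasCompactSupport
      (HasCompactSupport.intro (isCompact_closedBall 0 R) fun t ht => hz t (by simpa using ht))
      ).restrict _
  set m := ∫ s in (-T)..T, h s with hm
  have hmb : ‖m‖ₑ ≤ C * ENNReal.ofReal (ε / (1 + M)) := by
    have := hb _ (hg.sub hhm) T hr
    simp only [Pi.sub_apply] at this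
    rw [intervalIntegral.integral_sub
      (intervalIntegrable_of_integrableOn_Ioo (hg.integrable h1) hl hr)
      (intervalIntegrable_of_integrableOn_Ioo (hhm.integrable h1) hl hr), h0, zero_sub,
      enorm_neg] at this
    exact this.trans (by gcongr)
  obtain ⟨hφ, hφd⟩ := isTestFun_primitive hRT (g := fun t => h t - m * β t)
    (hs.sub (contDiff_const.mul hβs))
    (fun t ht => by rw [hz t ht, hβz t (by linarith)]; simp)
    (by
      rw [intervalIntegral.integral_sub (hs.continuous.intervalIntegrable _ _)
        ((hβs.continuous.const_mul _).intervalIntegrable _ _),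
        intervalIntegral.integral_const_mul, hβi]
      simp [hm])
  refine ⟨_, hφ, ?_⟩
  rw [hφd]
  calc eLpNorm (fun t => g t - (h t - m * β t)) (ENNReal.ofReal p) (volume.restrict (Ioo (-T) T))
      = eLpNorm ((g - h) + m • β) (ENNReal.ofReal p) (volume.restrict (Ioo (-T) T)) := by
        congr 1; ext t; simp; ring
    _ ≤ eLpNorm (g - h) (ENNReal.ofReal p) (volume.restrict (Ioo (-T) T)) +
          eLpNorm (m • β) (ENNReal.ofReal p) (volume.restrict (Ioo (-T) T)) :=
        eLpNorm_add_le (hg.sub hhm).aestronglyMeasurable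
          (hβm.const_smul m).aestronglyMeasurable h1
    _ ≤ ENNReal.ofReal (ε / (1 + M)) + ENNReal.ofReal (ε / (1 + M)) * ENNReal.ofReal M := by
        rw [eLpNorm_const_smul, hM, ENNReal.ofReal_toReal hMtop]
        refine add_le_add hn ?_
        calc _ ≤ (C * ENNReal.ofReal (ε / (1 + M))) *
              eLpNorm β (ENNReal.ofReal p) (volume.restrict (Ioo (-T) T)) := by gcongr
          _ = _ := by ring
    _ = ENNReal.ofReal ε := by
        rw [← ENNReal.ofReal_mul (by positivity),
          ← ENNReal.ofReal_add (by positivity) (by positivity)]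
        congr 1; field_simp

/-- The element of `W₀^{1,p}(-T,T)` with prescribed mean-zero gradient. -/
lemma exists_W0_of_grad (hp : 1 < p) (hT : 0 < T) {g : ℝ → ℝ}
    (hg : MemLp g (ENNReal.ofReal p) (volume.restrict (Ioo (-T) T)))
    (h0 : ∫ s in (-T)..T, g s = 0) :
    ∃ u : W0 (Ioo (-T) T) p, u.grad = g ∧ u.toFun = fun t => ∫ s in (-T)..t, g s := by
  have h1 := one_le_ofReal_of_one_lt hp
  obtain ⟨C, hC, hb⟩ := exists_enorm_primitive_le (a := -T) (b := T) hp
  have hl : (-T) ∈ Icc (-T) T := ⟨le_rfl, by linarith⟩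
  have hgi : IntegrableOn g (Ioo (-T) T) := hg.integrable h1
  have hco := continuousOn_primitive_Icc hT hgi
  have hu : MemLp (fun t => ∫ s in (-T)..t, g s) (ENNReal.ofReal p)
      (volume.restrict (Ioo (-T) T)) := by
    obtain ⟨B, hB⟩ := isCompact_Icc.exists_bound_of_continuousOn hco
    refine MemLp.of_bound ((hco.mono Ioo_subset_Icc_self).aestronglyMeasurable measurableSet_Ioo)
      B ?_
    filter_upwards [ae_restrict_mem measurableSet_Ioo] with t ht
    exact hB t (Ioo_subset_Icc_self ht)
  choose φ hφ hφn using fun n : ℕ =>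
    exists_testFun_deriv_near hp hT hg h0 (ε := 1 / ((n : ℝ) + 1)) (by positivity)
  have hlim : Tendsto (fun n : ℕ => ENNReal.ofReal (1 / ((n : ℝ) + 1))) atTop (𝓝 0) := by
    have := (ENNReal.continuous_ofReal.tendsto 0).comp
      (tendsto_one_div_add_atTop_nhds_zero_nat (𝕜 := ℝ))
    rwa [ENNReal.ofReal_zero] at this
  have hlim2 : Tendsto (fun n => eLpNorm (fun t => g t - deriv (φ n) t) (ENNReal.ofReal p)
      (volume.restrict (Ioo (-T) T))) atTop (𝓝 0) :=
    tendsto_of_tendsto_of_tendsto_of_le_of_le tendsto_const_nhds hlim (fun _ => zero_le) hφn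
  refine ⟨⟨fun t => ∫ s in (-T)..t, g s, g, hu, hg, fun ψ hψ => ?_, φ, hφ, ?_, hlim2⟩, rfl, rfl⟩
  · have := integral_primitive_mul hT ((hψ.memLp_deriv 1).integrable le_rfl) hgi h0
    simp only [← hψ.eq_primitive] at this
    rw [← neg_eq_iff_eq_neg] at this
    simp only [mul_comm _ (deriv ψ _), mul_comm (g _)]
    exact this.symm
  · have hfin : Tendsto (fun n => eLpNorm (fun _ : ℝ => (1 : ℝ)) (ENNReal.ofReal p)
        (volume.restrict (Ioo (-T) T)) * (C * eLpNorm (fun t => g t - deriv (φ n) t)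
        (ENNReal.ofReal p) (volume.restrict (Ioo (-T) T)))) atTop (𝓝 0) := by
      have h2 := ENNReal.Tendsto.const_mul (a := C) hlim2 (Or.inr hC)
      rw [mul_zero] at h2
      have h3 := ENNReal.Tendsto.const_mul (a := eLpNorm (fun _ : ℝ => (1 : ℝ)) (ENNReal.ofReal p)
        (volume.restrict (Ioo (-T) T))) h2 (Or.inr (memLp_const 1).eLpNorm_ne_top)
      simpa using h3
    refine tendsto_of_tendsto_of_tendsto_of_le_of_le tendsto_const_nhds hfin (fun _ => zero_le)
      fun n => ?_
    have hmem := hg.sub ((hφ n).memLp_deriv (ENNReal.ofReal p))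
    set D := C * eLpNorm (fun t => g t - deriv (φ n) t)
        (ENNReal.ofReal p) (volume.restrict (Ioo (-T) T)) with hD
    have hDtop : D ≠ ⊤ := ENNReal.mul_ne_top hC hmem.eLpNorm_ne_top
    -- Convergence of the functions comes from that of the gradients: `D` bounds the difference of
    -- the primitives uniformly in `t`.
    have hpt : ∀ᵐ t ∂(volume.restrict (Ioo (-T) T)),
        ‖(∫ s in (-T)..t, g s) - φ n t‖ ≤ ‖(D.toReal • fun _ : ℝ => (1 : ℝ)) t‖ := by
      filter_upwards [ae_restrict_mem measurableSet_Ioo] with t ht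
      have htc := Ioo_subset_Icc_self ht
      have := hb _ hmem t htc
      simp only [Pi.sub_apply] at this
      rw [intervalIntegral.integral_sub (intervalIntegrable_of_integrableOn_Ioo hgi hl htc)
        ((hφ n).continuous_deriv.intervalIntegrable _ _), ← (hφ n).eq_primitive] at this
      have h4 := ENNReal.toReal_mono hDtop this
      simpa [abs_of_nonneg] using h4
    refine (eLpNorm_mono_ae hpt).trans ?_
    rw [eLpNorm_const_smul, mul_comm]
    gcongr
    rw [Real.enorm_eq_ofReal ENNReal.toReal_nonneg, ENNReal.ofReal_toReal hDtop]

end Construction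

/-! ### The generalized `p`-sine function -/

/-- `w` is the increasing part of the generalized `p`-sine function on `[0, L]`, continued by
constants. -/
structure IsPSine (p L : ℝ) (w : ℝ → ℝ) : Prop where
  pos : 0 < L
  continuous : Continuous w
  eq_zero : ∀ x, x ≤ 0 → w x = 0
  eq_one : ∀ x, L ≤ x → w x = 1
  pos_of_mem : ∀ x ∈ Ioo 0 L, 0 < w x
  lt_one_of_mem : ∀ x ∈ Ioo 0 L, w x < 1
  hasDerivAt : ∀ x ∈ Ioo 0 L, HasDerivAt w ((1 - w x ^ p) ^ (1 / p)) x

/-- The only singularity is at `s = 1`, where `s^p ≤ s` compares it with `(1 - s)^{-1/p}`, and `1/p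
< 1`. The constant `1` is subtracted because the density is later extended by `1` outside `(0,1)`.
-/
lemma integrableOn_arcsine_density {p : ℝ} (hp : 1 < p) :
    IntegrableOn (fun s : ℝ => (1 - s ^ p) ^ (-(1 / p)) - 1) (Ioo 0 1) := by
  have hp0 : 0 < p := by linarith
  have h1 : IntegrableOn (fun s : ℝ => (1 - s) ^ (-(1 / p))) (Ioo 0 1) := by
    have h2 : IntervalIntegrable (fun s : ℝ => s ^ (-(1 / p))) volume 0 1 := by
      refine intervalIntegral.intervalIntegrable_rpow' ?_
      rw [neg_lt_neg_iff, div_lt_one hp0]; exact hp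
    have h3 := (h2.comp_sub_left 1).symm
    simp only [sub_zero, sub_self] at h3
    exact ((intervalIntegrable_iff_integrableOn_Ioc_of_le zero_le_one).1 h3).mono_set
      Ioo_subset_Ioc_self
  have h4 : IntegrableOn (fun s : ℝ => (1 - s ^ p) ^ (-(1 / p))) (Ioo 0 1) := by
    refine Integrable.mono' h1 (Measurable.aestronglyMeasurable (by fun_prop)) ?_
    filter_upwards [ae_restrict_mem measurableSet_Ioo] with s hs
    have h5 : s ^ p ≤ s := by
      simpa using Real.rpow_le_rpow_of_exponent_ge hs.1 hs.2.le hp.le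
    rw [Real.norm_of_nonneg (Real.rpow_nonneg (by linarith [hs.2]) _)]
    exact Real.rpow_le_rpow_of_nonpos (by linarith [hs.2]) (by linarith)
      (by rw [neg_nonpos]; positivity)
  exact h4.sub (integrableOn_const (by simp) (by simp))

/-- The `p`-arcsine `A` is the primitive of `(1 - s^p)^{-1/p}`. Extending this density by `1`
outside `(0,1)` keeps it at least `1`, so `A` is an increasing bijection of the whole line; `w` is
its inverse truncated to `[0,1]`, and `L = A 1`. -/
lemma exists_isPSine {p : ℝ} (hp : 1 < p) : ∃ L w, IsPSine p L w := by
  have hp0 : 0 < p := by linarith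
  set α : ℝ → ℝ := fun s => 1 + (Ioo (0 : ℝ) 1).indicator
    (fun s => (1 - s ^ p) ^ (-(1 / p)) - 1) s with hα
  have hpow : ∀ s ∈ Ioo (0 : ℝ) 1, 0 < s ^ p ∧ s ^ p < 1 := fun s hs =>
    ⟨Real.rpow_pos_of_pos hs.1 p, Real.rpow_lt_one hs.1.le hs.2 hp0⟩
  have hα_eq : ∀ s ∈ Ioo (0 : ℝ) 1, α s = (1 - s ^ p) ^ (-(1 / p)) := fun s hs => by
    simp [hα, indicator_of_mem hs]
  have hα1 : ∀ s, 1 ≤ α s := by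
    intro s
    by_cases hs : s ∈ Ioo (0 : ℝ) 1
    · rw [hα_eq s hs]
      exact Real.one_le_rpow_of_pos_of_le_one_of_nonpos (by linarith [(hpow s hs).2])
        (by linarith [(hpow s hs).1]) (by rw [neg_nonpos]; positivity)
    · simp [hα, indicator_of_notMem hs]
  have hαi : ∀ a b, IntervalIntegrable α volume a b := fun a b =>
    (intervalIntegrable_const).add
      ((integrable_indicator_iff measurableSet_Ioo).2
        (integrableOn_arcsine_density hp)).intervalIntegrable
  set A : ℝ → ℝ := fun x => ∫ s in (0 : ℝ)..x, α s with hA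
  have hAc : Continuous A := intervalIntegral.continuous_primitive hαi 0
  have hA0 : A 0 = 0 := by simp [hA]
  have hAle : ∀ x y, x ≤ y → y - x ≤ A y - A x := by
    intro x y hxy
    rw [hA]
    simp only
    rw [intervalIntegral.integral_interval_sub_left (hαi _ _) (hαi _ _)]
    calc y - x = ∫ _ in x..y, (1 : ℝ) := by simp
      _ ≤ _ := intervalIntegral.integral_mono_on hxy (by simp) (hαi _ _) fun s _ => hα1 s
  have hAmono : StrictMono A := fun x y hxy => by linarith [hAle x y hxy.le]
  have hAsurj : Function.Surjective A := by
    refine hAc.surjective ?_ ?_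
    · refine tendsto_atTop_mono' atTop ?_ tendsto_id
      filter_upwards [eventually_ge_atTop 0] with x hx
      have := hAle 0 x hx
      simp only [id]; linarith
    · refine tendsto_atBot_mono' atBot ?_ tendsto_id
      filter_upwards [eventually_le_atBot 0] with x hx
      have := hAle x 0 hx
      simp only [id]; linarith
  set e := hAmono.orderIsoOfSurjective A hAsurj with he
  have heA : ∀ x, e x = A x := fun x => rfl
  have hlt : ∀ x y, e.symm x < y ↔ x < A y := fun x y => by
    rw [← heA, OrderIso.symm_apply_lt]
  have hgt : ∀ x y, y < e.symm x ↔ A y < x := fun x y => by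
    rw [← heA, OrderIso.lt_symm_apply]
  refine ⟨A 1, fun x => max 0 (min 1 (e.symm x)), ?_, ?_, ?_, ?_, ?_, ?_, ?_⟩
  · have := hAle 0 1 zero_le_one; linarith
  · exact continuous_const.max (continuous_const.min e.symm.continuous)
  · intro x hx
    have : e.symm x ≤ 0 := by
      rw [← not_lt, hgt, not_lt, hA0]; exact hx
    exact max_eq_left (min_le_of_right_le this)
  · intro x hx
    have : 1 ≤ e.symm x := by rw [← not_lt, hlt, not_lt]; exact hx
    rw [min_eq_left this]; exact max_eq_right zero_le_one
  all_goals
    intro x hx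
    have hm1 : 0 < e.symm x := by rw [hgt, hA0]; exact hx.1
    have hm2 : e.symm x < 1 := by rw [hlt]; exact hx.2
    have hw : max 0 (min 1 (e.symm x)) = e.symm x := by
      rw [min_eq_right hm2.le, max_eq_right hm1.le]
  · simpa only [hw] using hm1
  · simpa only [hw] using hm2
  · simp only [hw]
    set y := e.symm x with hy
    have hym : y ∈ Ioo (0 : ℝ) 1 := ⟨hm1, hm2⟩
    have hev : α =ᶠ[𝓝 y] fun s => (1 - s ^ p) ^ (-(1 / p)) := by
      filter_upwards [isOpen_Ioo.mem_nhds hym] with s hs using hα_eq s hs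
    have hcont : ContinuousAt α y := by
      refine ContinuousAt.congr ?_ hev.symm
      refine ContinuousAt.rpow_const ?_ (Or.inl (by linarith [(hpow y hym).2]))
      exact continuousAt_const.sub (Real.continuousAt_rpow_const _ _ (Or.inl hm1.ne'))
    have hmeas : StronglyMeasurableAtFilter α (𝓝 y) volume := by
      refine Measurable.stronglyMeasurable ?_ |>.stronglyMeasurableAtFilter
      exact measurable_const.add (Measurable.indicator (by fun_prop) measurableSet_Ioo)
    have hdA : HasDerivAt A (α y) y :=
      intervalIntegral.integral_hasDerivAt_right (hαi _ _) hmeas hcont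
    have hinv : HasDerivAt e.symm (α y)⁻¹ x :=
      HasDerivAt.of_local_left_inverse (f := A) e.symm.continuous.continuousAt hdA
        (by linarith [hα1 y]) (Eventually.of_forall fun z => e.apply_symm_apply z)
    have hval : (α y)⁻¹ = (1 - y ^ p) ^ (1 / p) := by
      rw [hα_eq y hym, Real.rpow_neg (by linarith [(hpow y hym).2]), inv_inv]
    rw [hval] at hinv
    refine hinv.congr_of_eventuallyEq ?_
    filter_upwards [isOpen_Ioo.mem_nhds hx] with z hz
    have h1 : 0 < e.symm z := by rw [hgt, hA0]; exact hz.1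
    have h2 : e.symm z < 1 := by rw [hlt]; exact hz.2
    rw [min_eq_right h2.le, max_eq_right h1.le]

namespace IsPSine

variable {p L : ℝ} {w : ℝ → ℝ}

lemma nonneg (hw : IsPSine p L w) (x : ℝ) : 0 ≤ w x := by
  rcases le_or_gt x 0 with h | h
  · rw [hw.eq_zero x h]
  rcases le_or_gt L x with h2 | h2
  · rw [hw.eq_one x h2]; exact zero_le_one
  · exact (hw.pos_of_mem x ⟨h, h2⟩).le

lemma le_one (hw : IsPSine p L w) (x : ℝ) : w x ≤ 1 := by
  rcases le_or_gt x 0 with h | h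
  · rw [hw.eq_zero x h]; exact zero_le_one
  rcases le_or_gt L x with h2 | h2
  · rw [hw.eq_one x h2]
  · exact (hw.lt_one_of_mem x ⟨h, h2⟩).le

lemma pos_of_pos (hw : IsPSine p L w) {x : ℝ} (h : 0 < x) : 0 < w x := by
  rcases le_or_gt L x with h2 | h2
  · rw [hw.eq_one x h2]; exact zero_lt_one
  · exact hw.pos_of_mem x ⟨h, h2⟩

/-- The derivative `(1 - w^p)^{1/p}` of the `p`-sine. -/
def cosine (p : ℝ) (w : ℝ → ℝ) (x : ℝ) : ℝ := (1 - w x ^ p) ^ (1 / p)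

lemma one_sub_nonneg (hw : IsPSine p L w) (hp : 1 < p) (x : ℝ) : 0 ≤ 1 - w x ^ p :=
  sub_nonneg.2 (Real.rpow_le_one (hw.nonneg x) (hw.le_one x) (by linarith))

lemma cosine_nonneg (hw : IsPSine p L w) (hp : 1 < p) (x : ℝ) : 0 ≤ cosine p w x :=
  Real.rpow_nonneg (hw.one_sub_nonneg hp x) _

lemma cosine_pos (hw : IsPSine p L w) (hp : 1 < p) {x : ℝ} (hx : x ∈ Ioo 0 L) :
    0 < cosine p w x := by
  have h1 := Real.rpow_lt_one (hw.nonneg x) (hw.lt_one_of_mem x hx) (by linarith : 0 < p)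
  exact Real.rpow_pos_of_pos (by linarith) _

lemma cosine_eq_zero (hw : IsPSine p L w) (hp : 1 < p) {x : ℝ} (hx : L ≤ x) :
    cosine p w x = 0 := by
  have : 1 / p ≠ 0 := by positivity
  rw [cosine, hw.eq_one x hx, Real.one_rpow, sub_self, Real.zero_rpow this]

lemma continuous_cosine (hw : IsPSine p L w) (hp : 1 < p) : Continuous (cosine p w) := by
  have h1 : Continuous fun x => 1 - w x ^ p :=
    continuous_const.sub (hw.continuous.rpow_const fun _ => Or.inr (by linarith))
  exact h1.rpow_const fun _ => Or.inr (by positivity)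

/-- The equation `((w')^{p-1})' = -(p-1) w^{p-1}`. -/
lemma hasDerivAt_cosine_rpow (hw : IsPSine p L w) (hp : 1 < p) {x : ℝ} (hx : x ∈ Ioo 0 L) :
    HasDerivAt (fun x => cosine p w x ^ (p - 1)) (-((p - 1) * w x ^ (p - 1))) x := by
  have hp0 : 0 < p := by linarith
  have hwx := hw.pos_of_mem x hx
  have hlt : 0 < 1 - w x ^ p := by
    linarith [Real.rpow_lt_one (hw.nonneg x) (hw.lt_one_of_mem x hx) hp0]
  have heq : (fun x => cosine p w x ^ (p - 1)) = fun x => (1 - w x ^ p) ^ ((p - 1) / p) := by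
    ext y
    rw [cosine, ← Real.rpow_mul (hw.one_sub_nonneg hp y)]
    congr 1; ring
  rw [heq]
  have h1 := (((hw.hasDerivAt x hx).rpow_const (p := p) (Or.inl hwx.ne')).const_sub 1).rpow_const
    (p := (p - 1) / p) (Or.inl hlt.ne')
  convert h1 using 1
  -- The power of `1 - w^p` produced by the chain rule cancels against `w'`.
  have h2 : (1 - w x ^ p) ^ (1 / p) * (1 - w x ^ p) ^ ((p - 1) / p - 1) = 1 := by
    rw [← Real.rpow_add hlt, show 1 / p + ((p - 1) / p - 1) = 0 by field_simp; ring,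
      Real.rpow_zero]
  calc -((p - 1) * w x ^ (p - 1)) = -((p - 1) * w x ^ (p - 1)) *
        ((1 - w x ^ p) ^ (1 / p) * (1 - w x ^ p) ^ ((p - 1) / p - 1)) := by rw [h2, mul_one]
    _ = _ := by field_simp

end IsPSine

/-! ### Elementary properties of `H_{a,b}` and of powers -/

lemma Hab_of_pos (a b : ℝ) {t : ℝ} (h : 0 ≤ t) : Hab a b t = a * t := by
  simp [Hab, h]

lemma Hab_of_neg (a b : ℝ) {t : ℝ} (h : t ≤ 0) : Hab a b t = b * (-t) := by
  simp [Hab, h]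

lemma Hab_nonneg {a b : ℝ} (ha : 0 ≤ a) (hb : 0 ≤ b) (t : ℝ) : 0 ≤ Hab a b t := by
  unfold Hab; positivity

/-- This and `neg_mul_le_Hab` are the two supporting lines of `H_{a,b}`: the only way convexity
enters Picone's inequality. -/
lemma mul_le_Hab {a b : ℝ} (ha : 0 ≤ a) (hb : 0 ≤ b) (t : ℝ) : a * t ≤ Hab a b t := by
  rcases le_total 0 t with h | h
  · rw [Hab_of_pos a b h]
  · rw [Hab_of_neg a b h]; nlinarith

lemma neg_mul_le_Hab {a b : ℝ} (ha : 0 ≤ a) (hb : 0 ≤ b) (t : ℝ) : -b * t ≤ Hab a b t := by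
  rcases le_total 0 t with h | h
  · rw [Hab_of_pos a b h]; nlinarith
  · rw [Hab_of_neg a b h]; linarith

lemma Hab_neg (a b t : ℝ) : Hab a b (-t) = Hab b a t := by
  simp only [Hab, neg_neg]; ring

lemma continuous_Hab (a b : ℝ) : Continuous (Hab a b) := by unfold Hab; fun_prop

lemma young_rpow {p X Y : ℝ} (hp : 1 < p) (hX : 0 ≤ X) (hY : 0 ≤ Y) :
    p * X ^ (p - 1) * Y ≤ (p - 1) * X ^ p + Y ^ p := by
  have hp0 : 0 < p := by linarith
  have hc : (p / (p - 1)).HolderConjugate p := by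
    have := (Real.HolderConjugate.conjExponent hp).symm
    simpa [Real.conjExponent] using this
  have h := Real.young_inequality_of_nonneg (Real.rpow_nonneg hX (p - 1)) hY hc
  rw [← Real.rpow_mul hX, show (p - 1) * (p / (p - 1)) = p by
    have : p - 1 ≠ 0 := by linarith
    field_simp] at h
  have h2 := mul_le_mul_of_nonneg_left h hp0.le
  have h3 : p * (X ^ p / (p / (p - 1)) + Y ^ p / p) = (p - 1) * X ^ p + Y ^ p := by
    have : p - 1 ≠ 0 := by linarith
    field_simp
  rw [h3] at h2
  linarith

/-- At the origin the function is dominated by `|x|^p`, whose derivative vanishes there as `p > 1`.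
-/
lemma hasDerivAt_max_rpow {p : ℝ} (hp : 1 < p) (x : ℝ) :
    HasDerivAt (fun x : ℝ => max x 0 ^ p) (p * max x 0 ^ (p - 1)) x := by
  rcases lt_trichotomy x 0 with h | h | h
  · rw [max_eq_right h.le, Real.zero_rpow (by linarith), mul_zero]
    refine (hasDerivAt_const x (0 : ℝ)).congr_of_eventuallyEq ?_
    filter_upwards [isOpen_Iio.mem_nhds h] with y hy
    rw [max_eq_right (le_of_lt hy), Real.zero_rpow (by linarith)]
  · subst h
    have h1 := hasDerivAt_abs_rpow 0 hp
    rw [hasDerivAt_iff_isLittleO] at h1 ⊢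
    simp only [max_self, Real.zero_rpow (by linarith : p - 1 ≠ 0),
      Real.zero_rpow (by linarith : p ≠ 0), abs_zero, mul_zero, sub_zero, smul_eq_mul] at h1 ⊢
    refine Asymptotics.IsBigO.trans_isLittleO (Asymptotics.IsBigO.of_bound 1 ?_) h1
    refine Eventually.of_forall fun y => ?_
    rw [one_mul, Real.norm_of_nonneg (by positivity), Real.norm_of_nonneg (by positivity)]
    exact Real.rpow_le_rpow (le_max_right _ _) (max_le (le_abs_self y) (abs_nonneg y))
      (by linarith)
  · rw [max_eq_left h.le]
    refine (Real.hasDerivAt_rpow_const (p := p) (Or.inl h.ne')).congr_of_eventuallyEq ?_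
    filter_upwards [isOpen_Ioi.mem_nhds h] with y hy
    rw [max_eq_left (le_of_lt hy)]

/-! ### The explicit ground state -/

section GroundState

variable {p L T a b : ℝ} {w : ℝ → ℝ}

/-- The frequency parameter of the ground state on `(-T, T)`. -/
def gsFreq (L T a b : ℝ) : ℝ := L * (a + b) / (2 * T)

/-- The point where the ground state attains its maximum. -/
def gsTop (T a b : ℝ) : ℝ := T * (a - b) / (a + b)

/-- The ground state for `H_{a,b}`. -/
def gsFun (w : ℝ → ℝ) (L T a b t : ℝ) : ℝ :=
  w (gsFreq L T a b / a * (t + T)) + w (gsFreq L T a b / b * (T - t)) - 1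

/-- The derivative of the ground state. -/
def gsGrad (p : ℝ) (w : ℝ → ℝ) (L T a b t : ℝ) : ℝ :=
  gsFreq L T a b / a * IsPSine.cosine p w (gsFreq L T a b / a * (t + T)) -
    gsFreq L T a b / b * IsPSine.cosine p w (gsFreq L T a b / b * (T - t))

/-- The flux `H(v')^{p-1} H'(v')` of the ground state. -/
def gsFlux (p : ℝ) (w : ℝ → ℝ) (L T a b t : ℝ) : ℝ :=
  a * gsFreq L T a b ^ (p - 1) *
      IsPSine.cosine p w (gsFreq L T a b / a * (t + T)) ^ (p - 1) -
    b * gsFreq L T a b ^ (p - 1) *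
      IsPSine.cosine p w (gsFreq L T a b / b * (T - t)) ^ (p - 1)

lemma gsFreq_comm : gsFreq L T a b = gsFreq L T b a := by simp [gsFreq, add_comm]

lemma gsTop_comm : gsTop T a b = -gsTop T b a := by
  simp only [gsTop, add_comm b a, ← neg_div]; ring

/-- Reflection exchanges `a` and `b`. Hence only the part to the left of the peak is computed below,
and the right part follows by symmetry. -/
lemma gsFun_neg (t : ℝ) : gsFun w L T a b (-t) = gsFun w L T b a t := by
  simp only [gsFun, gsFreq_comm (a := b)]
  rw [show -t + T = T - t by ring, show T - -t = t + T by ring]; ring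

lemma gsGrad_neg (t : ℝ) : gsGrad p w L T a b (-t) = -gsGrad p w L T b a t := by
  simp only [gsGrad, gsFreq_comm (a := b)]
  rw [show -t + T = T - t by ring, show T - -t = t + T by ring]; ring

lemma gsFlux_neg (t : ℝ) : gsFlux p w L T a b (-t) = -gsFlux p w L T b a t := by
  simp only [gsFlux, gsFreq_comm (a := b)]
  rw [show -t + T = T - t by ring, show T - -t = t + T by ring]; ring

lemma gsFreq_pos (hL : 0 < L) (hT : 0 < T) (ha : 0 < a) (hb : 0 < b) : 0 < gsFreq L T a b := by
  unfold gsFreq; positivity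

lemma gsTop_mem (hT : 0 < T) (ha : 0 < a) (hb : 0 < b) : gsTop T a b ∈ Ioo (-T) T := by
  unfold gsTop
  constructor
  · rw [lt_div_iff₀ (by positivity)]; nlinarith
  · rw [div_lt_iff₀ (by positivity)]; nlinarith

/-- `gsFreq` and `gsTop` are the solution of two equations: both phases must equal `L` at the same
point, the peak. -/
lemma gs_phase_left (hT : 0 < T) (ha : 0 < a) (hb : 0 < b) (t : ℝ) :
    gsFreq L T a b / a * (t + T) = L + gsFreq L T a b / a * (t - gsTop T a b) := by
  unfold gsFreq gsTop; field_simp; ring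

lemma gs_phase_right (hT : 0 < T) (ha : 0 < a) (hb : 0 < b) (t : ℝ) :
    gsFreq L T a b / b * (T - t) = L + gsFreq L T a b / b * (gsTop T a b - t) := by
  unfold gsFreq gsTop; field_simp; ring

lemma gs_phase_left_mem (hL : 0 < L) (hT : 0 < T) (ha : 0 < a) (hb : 0 < b) {t : ℝ}
    (ht : t ∈ Ioo (-T) (gsTop T a b)) : gsFreq L T a b / a * (t + T) ∈ Ioo 0 L := by
  have hk := gsFreq_pos hL hT ha hb
  have hka : 0 < gsFreq L T a b / a := by positivity
  refine ⟨mul_pos hka (by linarith [ht.1]), ?_⟩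
  rw [gs_phase_left hT ha hb]
  nlinarith [mul_pos hka (sub_pos.2 ht.2)]

lemma gs_phase_left_ge (hL : 0 < L) (hT : 0 < T) (ha : 0 < a) (hb : 0 < b) {t : ℝ}
    (ht : gsTop T a b ≤ t) : L ≤ gsFreq L T a b / a * (t + T) := by
  have hk := gsFreq_pos hL hT ha hb
  rw [gs_phase_left hT ha hb]
  have : 0 ≤ gsFreq L T a b / a * (t - gsTop T a b) :=
    mul_nonneg (by positivity) (by linarith)
  linarith

lemma gs_phase_right_ge (hL : 0 < L) (hT : 0 < T) (ha : 0 < a) (hb : 0 < b) {t : ℝ}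
    (ht : t ≤ gsTop T a b) : L ≤ gsFreq L T a b / b * (T - t) := by
  have hk := gsFreq_pos hL hT ha hb
  rw [gs_phase_right hT ha hb]
  have : 0 ≤ gsFreq L T a b / b * (gsTop T a b - t) :=
    mul_nonneg (by positivity) (by linarith)
  linarith

namespace IsPSine

lemma continuous_gsFun (hw : IsPSine p L w) : Continuous (gsFun w L T a b) := by
  have := hw.continuous
  unfold gsFun; fun_prop

lemma continuous_gsGrad (hw : IsPSine p L w) (hp : 1 < p) : Continuous (gsGrad p w L T a b) := by
  have := hw.continuous_cosine hp
  unfold gsGrad; fun_prop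

lemma continuous_gsFlux (hw : IsPSine p L w) (hp : 1 < p) : Continuous (gsFlux p w L T a b) := by
  have h1 : Continuous fun x => cosine p w x ^ (p - 1) :=
    (hw.continuous_cosine hp).rpow_const fun _ => Or.inr (by linarith)
  unfold gsFlux
  exact (continuous_const.mul (h1.comp (by fun_prop : Continuous fun t =>
    gsFreq L T a b / a * (t + T)))).sub (continuous_const.mul (h1.comp
      (by fun_prop : Continuous fun t => gsFreq L T a b / b * (T - t))))

/-- To the left of the peak the right-hand phase is at least `L`, where `w` equals `1` and cancels
the `-1` in `gsFun`. This makes the sum of two `p`-sines a gluing. -/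
lemma gsFun_left (hw : IsPSine p L w) (hT : 0 < T) (ha : 0 < a) (hb : 0 < b) {t : ℝ}
    (ht : t ≤ gsTop T a b) :
    gsFun w L T a b t = w (gsFreq L T a b / a * (t + T)) := by
  rw [gsFun, hw.eq_one _ (gs_phase_right_ge hw.pos hT ha hb ht)]; ring

lemma gsFun_pos (hw : IsPSine p L w) (hT : 0 < T) (ha : 0 < a) (hb : 0 < b) {t : ℝ}
    (ht : t ∈ Ioo (-T) T) : 0 < gsFun w L T a b t := by
  have hk := gsFreq_pos hw.pos hT ha hb
  rcases le_total t (gsTop T a b) with h | h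
  · rw [hw.gsFun_left hT ha hb h]
    exact hw.pos_of_pos (mul_pos (by positivity) (by linarith [ht.1]))
  · rw [gsFun, hw.eq_one _ (gs_phase_left_ge hw.pos hT ha hb h), add_sub_cancel_left]
    exact hw.pos_of_pos (mul_pos (by positivity) (by linarith [ht.2]))

lemma gsFun_left_end (hw : IsPSine p L w) (hT : 0 < T) (ha : 0 < a) (hb : 0 < b) :
    gsFun w L T a b (-T) = 0 := by
  rw [hw.gsFun_left hT ha hb (gsTop_mem hT ha hb).1.le]
  exact hw.eq_zero _ (by simp)

lemma gsGrad_left (hw : IsPSine p L w) (hp : 1 < p) (hT : 0 < T)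
    (ha : 0 < a) (hb : 0 < b) {t : ℝ} (ht : t ≤ gsTop T a b) :
    gsGrad p w L T a b t =
      gsFreq L T a b / a * cosine p w (gsFreq L T a b / a * (t + T)) := by
  rw [gsGrad, hw.cosine_eq_zero hp (gs_phase_right_ge hw.pos hT ha hb ht)]; ring

lemma gsFlux_left (hw : IsPSine p L w) (hp : 1 < p) (hT : 0 < T)
    (ha : 0 < a) (hb : 0 < b) {t : ℝ} (ht : t ≤ gsTop T a b) :
    gsFlux p w L T a b t = a * gsFreq L T a b ^ (p - 1) *
      cosine p w (gsFreq L T a b / a * (t + T)) ^ (p - 1) := by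
  rw [gsFlux, hw.cosine_eq_zero hp (gs_phase_right_ge hw.pos hT ha hb ht),
    Real.zero_rpow (by linarith)]
  ring

lemma gsGrad_pos_left (hw : IsPSine p L w) (hp : 1 < p) (hT : 0 < T)
    (ha : 0 < a) (hb : 0 < b) {t : ℝ} (ht : t ∈ Ioo (-T) (gsTop T a b)) :
    0 < gsGrad p w L T a b t := by
  rw [hw.gsGrad_left hp hT ha hb ht.2.le]
  have hk := gsFreq_pos hw.pos hT ha hb
  have := hw.cosine_pos hp (gs_phase_left_mem hw.pos hT ha hb ht)
  positivity

lemma hasDerivAt_gsFun_left (hw : IsPSine p L w) (hp : 1 < p) (hT : 0 < T)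
    (ha : 0 < a) (hb : 0 < b) {t : ℝ} (ht : t ∈ Ioo (-T) (gsTop T a b)) :
    HasDerivAt (gsFun w L T a b) (gsGrad p w L T a b t) t := by
  rw [hw.gsGrad_left hp hT ha hb ht.2.le]
  have h1 : HasDerivAt (fun t => gsFreq L T a b / a * (t + T)) (gsFreq L T a b / a) t := by
    simpa using ((hasDerivAt_id t).add_const T).const_mul (gsFreq L T a b / a)
  have h2 := (hw.hasDerivAt _ (gs_phase_left_mem hw.pos hT ha hb ht)).comp t h1
  rw [mul_comm] at h2
  refine h2.congr_of_eventuallyEq ?_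
  filter_upwards [isOpen_Iio.mem_nhds ht.2] with x hx
  exact hw.gsFun_left hT ha hb (le_of_lt hx)

lemma hasDerivAt_gsFlux_left (hw : IsPSine p L w) (hp : 1 < p) (hT : 0 < T)
    (ha : 0 < a) (hb : 0 < b) {t : ℝ} (ht : t ∈ Ioo (-T) (gsTop T a b)) :
    HasDerivAt (gsFlux p w L T a b)
      (-((p - 1) * gsFreq L T a b ^ p * gsFun w L T a b t ^ (p - 1))) t := by
  have hk := gsFreq_pos hw.pos hT ha hb
  have h1 : HasDerivAt (fun t => gsFreq L T a b / a * (t + T)) (gsFreq L T a b / a) t := by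
    simpa using ((hasDerivAt_id t).add_const T).const_mul (gsFreq L T a b / a)
  have h2 := ((hw.hasDerivAt_cosine_rpow hp (gs_phase_left_mem hw.pos hT ha hb ht)).comp t
    h1).const_mul (a * gsFreq L T a b ^ (p - 1))
  rw [hw.gsFun_left hT ha hb ht.2.le]
  have h3 : gsFreq L T a b ^ p = gsFreq L T a b ^ (p - 1) * gsFreq L T a b := by
    rw [← Real.rpow_add_one hk.ne']; congr 1; ring
  have h4 := h2.congr_of_eventuallyEq (f₁ := gsFlux p w L T a b) (by
    filter_upwards [isOpen_Iio.mem_nhds ht.2] with x hx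
    exact hw.gsFlux_left hp hT ha hb (le_of_lt hx))
  refine h4.congr_deriv ?_
  rw [h3]; field_simp

lemma hasDerivAt_gsFun (hw : IsPSine p L w) (hp : 1 < p) (hT : 0 < T)
    (ha : 0 < a) (hb : 0 < b) {t : ℝ} (ht : t ∈ Ioo (-T) T) (hs : t ≠ gsTop T a b) :
    HasDerivAt (gsFun w L T a b) (gsGrad p w L T a b t) t := by
  rcases hs.lt_or_gt with h | h
  · exact hw.hasDerivAt_gsFun_left hp hT ha hb ⟨ht.1, h⟩
  · have h1 := (hw.hasDerivAt_gsFun_left (t := -t) hp hT hb ha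
      ⟨by linarith [ht.2], by rw [gsTop_comm]; linarith⟩).scomp t (hasDerivAt_neg t)
    have h2 : gsFun w L T b a ∘ Neg.neg = gsFun w L T a b := funext fun x => gsFun_neg x
    rw [gsGrad_neg] at h1
    simpa [h2] using h1

lemma hasDerivAt_gsFlux (hw : IsPSine p L w) (hp : 1 < p) (hT : 0 < T)
    (ha : 0 < a) (hb : 0 < b) {t : ℝ} (ht : t ∈ Ioo (-T) T) (hs : t ≠ gsTop T a b) :
    HasDerivAt (gsFlux p w L T a b)
      (-((p - 1) * gsFreq L T a b ^ p * gsFun w L T a b t ^ (p - 1))) t := by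
  rcases hs.lt_or_gt with h | h
  · exact hw.hasDerivAt_gsFlux_left hp hT ha hb ⟨ht.1, h⟩
  · have h1 := (hw.hasDerivAt_gsFlux_left (t := -t) hp hT hb ha
      ⟨by linarith [ht.2], by rw [gsTop_comm]; linarith⟩).scomp t (hasDerivAt_neg t)
    have h2 : (-(gsFlux p w L T b a ∘ Neg.neg)) = gsFlux p w L T a b :=
      funext fun x => by simp [gsFlux_neg]
    rw [gsFun_neg, gsFreq_comm] at h1
    have h3 := h1.neg
    rw [h2] at h3
    simpa using h3

/-- The ratio `h / v` in Picone's identity, with `h = H(v')`: the slope `d` is `a` on the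
increasing part and `-b` on the decreasing part. -/
lemma exists_gs_slope (hw : IsPSine p L w) (hp : 1 < p) (hT : 0 < T)
    (ha : 0 < a) (hb : 0 < b) {t : ℝ} (hs : t ≠ gsTop T a b) :
    ∃ d h : ℝ, (d = a ∨ d = -b) ∧ 0 ≤ h ∧ gsFlux p w L T a b t = d * h ^ (p - 1) ∧
      d * gsGrad p w L T a b t = h := by
  have key : ∀ {a b t : ℝ}, 0 < a → 0 < b → t < gsTop T a b → ∃ h : ℝ, 0 ≤ h ∧
      gsFlux p w L T a b t = a * h ^ (p - 1) ∧ a * gsGrad p w L T a b t = h := by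
    intro a b t ha hb ht
    have hk := gsFreq_pos hw.pos hT ha hb
    have hc := hw.cosine_nonneg hp (gsFreq L T a b / a * (t + T))
    refine ⟨gsFreq L T a b * cosine p w (gsFreq L T a b / a * (t + T)),
      mul_nonneg hk.le hc, ?_, ?_⟩
    · rw [hw.gsFlux_left hp hT ha hb ht.le, Real.mul_rpow hk.le hc]; ring
    · rw [hw.gsGrad_left hp hT ha hb ht.le]; field_simp
  rcases hs.lt_or_gt with h | h
  · obtain ⟨h, h0, h1, h2⟩ := key ha hb h
    exact ⟨a, h, Or.inl rfl, h0, h1, h2⟩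
  · obtain ⟨h, h0, h1, h2⟩ := key (t := -t) hb ha (by rw [gsTop_comm]; linarith)
    rw [gsFlux_neg] at h1
    rw [gsGrad_neg] at h2
    exact ⟨-b, h, Or.inr rfl, h0, by linarith, by linarith⟩

end IsPSine

end GroundState

/-! ### Picone's inequality and the sharp Poincaré inequality -/

section Picone

variable {p L T a b : ℝ} {w : ℝ → ℝ}

/-- The first eigenvalue for `H_{a,b}` on `(-T,T)`. -/
def gsLevel (p L T a b : ℝ) : ℝ := (p - 1) * gsFreq L T a b ^ p

lemma gsLevel_comm : gsLevel p L T a b = gsLevel p L T b a := by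
  simp [gsLevel, gsFreq_comm (a := a)]

/-- For the ground state `v`, the quotient of flux by `v^{p-1}` satisfies a Riccati equation: put `r
= h / v` with `h = d v'`, and use the quotient rule and the equation for the flux. -/
lemma IsPSine.hasDerivAt_piconeQuotient (hw : IsPSine p L w) (hp : 1 < p) (hT : 0 < T)
    (ha : 0 < a) (hb : 0 < b) {t : ℝ} (ht : t ∈ Ioo (-T) T) (hs : t ≠ gsTop T a b) :
    ∃ d r : ℝ, (d = a ∨ d = -b) ∧ 0 ≤ r ∧
      gsFlux p w L T a b t / gsFun w L T a b t ^ (p - 1) = d * r ^ (p - 1) ∧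
      HasDerivAt (fun t => gsFlux p w L T a b t / gsFun w L T a b t ^ (p - 1))
        (-gsLevel p L T a b - (p - 1) * r ^ p) t := by
  obtain ⟨d, h, hd, h0, hF, hg⟩ := hw.exists_gs_slope hp hT ha hb hs
  have hv := hw.gsFun_pos hT ha hb ht
  have h1 := (hw.hasDerivAt_gsFlux hp hT ha hb ht hs).div
    ((hw.hasDerivAt_gsFun hp hT ha hb ht hs).rpow_const (p := p - 1) (Or.inl hv.ne'))
    (Real.rpow_pos_of_pos hv _).ne'
  refine ⟨d, h / gsFun w L T a b t, hd, by positivity, ?_, h1.congr_deriv ?_⟩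
  · rw [hF, Real.div_rpow h0 hv.le]; ring
  · rw [hF]
    set v := gsFun w L T a b t
    set g := gsGrad p w L T a b t
    have hV : 0 < v ^ (p - 1) := Real.rpow_pos_of_pos hv _
    have e1 : v ^ (p - 1 - 1) = v ^ (p - 1) / v := by rw [Real.rpow_sub_one hv.ne']
    have e2 : (h / v) ^ p = d * h ^ (p - 1) * g / (v ^ (p - 1) * v) := by
      rw [Real.div_rpow h0 hv.le, ← Real.rpow_add_one hv.ne', sub_add_cancel]
      congr 1
      rw [show d * h ^ (p - 1) * g = h ^ (p - 1) * (d * g) by ring, hg]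
      rcases h0.eq_or_lt with h2 | h2
      · rw [← h2, Real.zero_rpow (by linarith), mul_zero]
      · rw [← Real.rpow_add_one h2.ne', sub_add_cancel]
    rw [e1, e2, gsLevel]
    field_simp

/-- The left side is the derivative of (Picone quotient) `· φ^p` with `P = φ` and `y = φ'`. Replace
`d * y` by `H`, then apply Young's inequality to `rP` and `H`. -/
lemma picone_pointwise {l d r y P H : ℝ} (hp : 1 < p) (hr : 0 ≤ r) (hP : 0 < P)
    (hH : 0 ≤ H) (hd : d * y ≤ H) :
    (-l - (p - 1) * r ^ p) * P ^ p + d * r ^ (p - 1) * (p * P ^ (p - 1) * y) ≤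
      H ^ p - l * P ^ p := by
  have hy := young_rpow hp (mul_nonneg hr hP.le) hH
  rw [Real.mul_rpow hr hP.le, Real.mul_rpow hr hP.le] at hy
  have h1 : p * (r ^ (p - 1) * P ^ (p - 1)) * (d * y) ≤
      p * (r ^ (p - 1) * P ^ (p - 1)) * H :=
    mul_le_mul_of_nonneg_left hd (by positivity)
  nlinarith

/-- The integrand dominates the derivative of `G`, the Picone quotient times `(φ^+)^p`, which
vanishes at both ends. As `G` is only known to be differentiable off the peak, the two sides are
integrated separately and joined by continuity. -/
lemma IsPSine.picone_testFun (hw : IsPSine p L w) (hp : 1 < p) (hT : 0 < T)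
    (ha : 0 < a) (hb : 0 < b) {φ : ℝ → ℝ} (hφ : IsTestFun (Ioo (-T) T) φ) :
    0 ≤ ∫ t in Ioo (-T) T, {t | 0 < φ t}.indicator
      (fun t => Hab a b (deriv φ t) ^ p - gsLevel p L T a b * φ t ^ p) t := by
  have hp0 : 0 < p := by linarith
  set f : ℝ → ℝ := {t | 0 < φ t}.indicator
      (fun t => Hab a b (deriv φ t) ^ p - gsLevel p L T a b * φ t ^ p) with hf
  set G : ℝ → ℝ := fun t => gsFlux p w L T a b t / gsFun w L T a b t ^ (p - 1) *
    max (φ t) 0 ^ p with hG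
  have hφc := hφ.1.continuous
  have hGc : Continuous G := by
    rw [continuous_iff_continuousAt]
    intro t
    -- The denominator vanishes at the end points, but `φ` is supported inside the interval, where
    -- the ground state is positive; off the support `G` is locally zero.
    by_cases ht : t ∈ tsupport φ
    · have hv := hw.gsFun_pos hT ha hb (hφ.2.2 ht)
      refine ContinuousAt.mul (ContinuousAt.div (hw.continuous_gsFlux hp).continuousAt
        (hw.continuous_gsFun.continuousAt.rpow_const (Or.inl hv.ne'))
        (Real.rpow_pos_of_pos hv _).ne') ?_
      exact ((hφc.max continuous_const).rpow_const fun _ => Or.inr hp0.le).continuousAt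
    · have h0 : G =ᶠ[𝓝 t] fun _ => 0 := by
        filter_upwards [notMem_tsupport_iff_eventuallyEq.1 ht] with x hx
        simp [hG, hx, Real.zero_rpow hp0.ne']
      exact continuousAt_const.congr h0.symm
  have hfi : ∀ c d : ℝ, IntegrableOn f (Icc c d) := fun c d => by
    have h1 : Continuous fun t => Hab a b (deriv φ t) ^ p - gsLevel p L T a b * φ t ^ p :=
      (((continuous_Hab a b).comp hφ.continuous_deriv).rpow_const fun _ => Or.inr hp0.le).sub
        (continuous_const.mul (hφc.rpow_const fun _ => Or.inr hp0.le))
    exact Integrable.indicator (h1.continuousOn.integrableOn_Icc)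
      (measurableSet_lt measurable_const hφc.measurable)
  have hder : ∀ t ∈ Ioo (-T) T, t ≠ gsTop T a b → ∃ D, HasDerivAt G D t ∧ D ≤ f t := by
    intro t ht hs
    obtain ⟨d, r, hd, hr, hQ, hQd⟩ := hw.hasDerivAt_piconeQuotient hp hT ha hb ht hs
    have h1 := hQd.mul ((hasDerivAt_max_rpow hp (φ t)).comp t (hφ.hasDerivAt t))
    refine ⟨_, h1, ?_⟩
    simp only [Function.comp_apply, hQ]
    rcases le_or_gt (φ t) 0 with h | h
    · rw [max_eq_right h, Real.zero_rpow hp0.ne', Real.zero_rpow (by linarith : p - 1 ≠ 0), hf,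
        indicator_of_notMem (by simpa using h)]
      simp
    · rw [max_eq_left h.le, hf, indicator_of_mem (by exact h)]
      refine picone_pointwise hp hr h (Hab_nonneg ha.le hb.le _) ?_
      rcases hd with rfl | rfl
      · exact mul_le_Hab ha.le hb.le _
      · exact neg_mul_le_Hab ha.le hb.le _
  choose! D hD hDf using hder
  have hs := gsTop_mem hT ha hb
  have hl := intervalIntegral.sub_le_integral_of_hasDeriv_right_of_le (g := G) (g' := D) (φ := f)
    hs.1.le hGc.continuousOn
    (fun t ht => (hD t ⟨ht.1, ht.2.trans hs.2⟩ ht.2.ne).hasDerivWithinAt)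
    (hfi _ _) (fun t ht => hDf t ⟨ht.1, ht.2.trans hs.2⟩ ht.2.ne)
  have hr := intervalIntegral.sub_le_integral_of_hasDeriv_right_of_le (g := G) (g' := D) (φ := f)
    hs.2.le hGc.continuousOn
    (fun t ht => (hD t ⟨hs.1.trans ht.1, ht.2⟩ ht.1.ne').hasDerivWithinAt)
    (hfi _ _) (fun t ht => hDf t ⟨hs.1.trans ht.1, ht.2⟩ ht.1.ne')
  have hii : ∀ c d : ℝ, c ≤ d → IntervalIntegrable f volume c d := fun c d hcd =>
    (intervalIntegrable_iff_integrableOn_Icc_of_le hcd).2 (hfi c d)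
  rw [← intervalIntegral_eq_setIntegral_Ioo (by linarith),
    ← intervalIntegral.integral_add_adjacent_intervals (hii _ _ hs.1.le) (hii _ _ hs.2.le)]
  have e1 : G (-T) = 0 := by
    simp [hG, hφ.eq_zero_of_notMem (t := -T) (by simp), Real.zero_rpow hp0.ne']
  have e2 : G T = 0 := by
    simp [hG, hφ.eq_zero_of_notMem (t := T) (by simp), Real.zero_rpow hp0.ne']
  linarith

lemma IsTestFun.neg {Ω : Set ℝ} {φ : ℝ → ℝ} (h : IsTestFun Ω φ) :
    IsTestFun Ω (fun t => -φ t) := by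
  refine ⟨h.1.neg, h.2.1.neg, ?_⟩
  have : tsupport (fun t => -φ t) = tsupport φ := by
    simp only [tsupport, Function.support_fun_neg]
  rw [this]; exact h.2.2

lemma integrableOn_of_continuous {f : ℝ → ℝ} (hf : Continuous f) (c d : ℝ) :
    IntegrableOn f (Ioo c d) :=
  (hf.continuousOn.integrableOn_Icc (a := c) (b := d)).mono_set Ioo_subset_Icc_self

/-- The sharp anisotropic Poincaré inequality for test functions. -/
lemma IsPSine.poincare_testFun (hw : IsPSine p L w) (hp : 1 < p) (hT : 0 < T)
    (ha : 0 < a) (hb : 0 < b) {φ : ℝ → ℝ} (hφ : IsTestFun (Ioo (-T) T) φ) :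
    gsLevel p L T a b * ∫ t in Ioo (-T) T, |φ t| ^ p ≤
      ∫ t in Ioo (-T) T, Hab a b (deriv φ t) ^ p := by
  have hp0 : 0 < p := by linarith
  have h1 := hw.picone_testFun hp hT ha hb hφ
  -- The negative part of `φ` is the positive part of `-φ`, and the change of sign swaps `a` and `b`
  -- while leaving the level unchanged.
  have h2 := hw.picone_testFun hp hT hb ha hφ.neg
  have hφc := hφ.1.continuous
  have hH : ∀ a b, Continuous fun t => Hab a b (deriv φ t) ^ p := fun a b =>
    ((continuous_Hab a b).comp hφ.continuous_deriv).rpow_const fun _ => Or.inr hp0.le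
  have hA : Continuous fun t => |φ t| ^ p := hφc.abs.rpow_const fun _ => Or.inr hp0.le
  have e1 : ∀ t, {t | 0 < φ t}.indicator
      (fun t => Hab a b (deriv φ t) ^ p - gsLevel p L T a b * φ t ^ p) t = {t | 0 < φ t}.indicator
      (fun t => Hab a b (deriv φ t) ^ p - gsLevel p L T a b * |φ t| ^ p) t := by
    intro t
    by_cases h : 0 < φ t
    · rw [indicator_of_mem (by exact h), indicator_of_mem (by exact h), abs_of_pos h]
    · rw [indicator_of_notMem (by exact h), indicator_of_notMem (by exact h)]
  have e2 : ∀ t, {t | 0 < -φ t}.indicator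
      (fun t => Hab b a (deriv (fun t => -φ t) t) ^ p - gsLevel p L T b a * (-φ t) ^ p) t =
      {t | φ t < 0}.indicator
      (fun t => Hab a b (deriv φ t) ^ p - gsLevel p L T a b * |φ t| ^ p) t := by
    intro t
    by_cases h : φ t < 0
    · have h' : 0 < -φ t := by linarith
      rw [indicator_of_mem (by exact h'), indicator_of_mem (by exact h), abs_of_neg h,
        deriv.fun_neg, Hab_neg, gsLevel_comm]
    · have h' : ¬ 0 < -φ t := by linarith
      rw [indicator_of_notMem (by exact h'), indicator_of_notMem (by exact h)]
  simp only [e1] at h1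
  simp only [e2] at h2
  have hc : Continuous fun t => Hab a b (deriv φ t) ^ p - gsLevel p L T a b * |φ t| ^ p :=
    (hH a b).sub (continuous_const.mul hA)
  have i1 : IntegrableOn ({t | 0 < φ t}.indicator
      (fun t => Hab a b (deriv φ t) ^ p - gsLevel p L T a b * |φ t| ^ p)) (Ioo (-T) T) :=
    Integrable.indicator (integrableOn_of_continuous hc _ _)
      (measurableSet_lt measurable_const hφc.measurable)
  have i2 : IntegrableOn ({t | φ t < 0}.indicator
      (fun t => Hab a b (deriv φ t) ^ p - gsLevel p L T a b * |φ t| ^ p)) (Ioo (-T) T) :=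
    Integrable.indicator (integrableOn_of_continuous hc _ _)
      (measurableSet_lt hφc.measurable measurable_const)
  have h3 : 0 ≤ ∫ t in Ioo (-T) T,
      (Hab a b (deriv φ t) ^ p - gsLevel p L T a b * |φ t| ^ p) := by
    refine (add_nonneg h1 h2).trans ?_
    rw [← integral_add i1 i2]
    -- The two indicators miss only the set `φ = 0`, where the full integrand is a power of `H` and
    -- so non-negative.
    refine integral_mono (i1.add i2) (integrableOn_of_continuous hc _ _) fun t => ?_
    rcases lt_trichotomy (φ t) 0 with h | h | h
    · simp [h, h.not_gt]
    · have := Real.rpow_nonneg (Hab_nonneg ha.le hb.le (deriv φ t)) p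
      simpa [indicator_apply, h, Real.zero_rpow hp0.ne'] using this
    · simp [h, h.not_gt]
  rw [integral_sub (integrableOn_of_continuous (hH a b) _ _)
    ((integrableOn_of_continuous hA _ _).const_mul _), integral_const_mul] at h3
  linarith

lemma lipschitz_posPart : LipschitzWith 1 (fun x : ℝ => max x 0) := LipschitzWith.id.max_const 0

lemma lipschitz_negPart : LipschitzWith 1 (fun x : ℝ => max (-x) 0) :=
  LipschitzWith.id.neg.max_const 0

lemma lipschitz_abs : LipschitzWith 1 (fun x : ℝ => |x|) :=
  lipschitzWith_one_norm (E := ℝ)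

lemma Hab_rpow (hp : 1 < p) {a b : ℝ} (ha : 0 ≤ a) (hb : 0 ≤ b) (t : ℝ) :
    Hab a b t ^ p = a ^ p * max t 0 ^ p + b ^ p * max (-t) 0 ^ p := by
  have hp0 : p ≠ 0 := by linarith
  rcases le_total 0 t with h | h
  · rw [Hab_of_pos a b h, max_eq_left h, max_eq_right (by linarith : -t ≤ 0),
      Real.mul_rpow ha h, Real.zero_rpow hp0]; ring
  · rw [Hab_of_neg a b h, max_eq_right h, max_eq_left (by linarith : 0 ≤ -t),
      Real.mul_rpow hb (by linarith), Real.zero_rpow hp0]; ring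

lemma integrable_rpow_comp {μ : Measure ℝ} (hp : 1 < p) {K : ℝ → ℝ}
    (hK : LipschitzWith 1 K) (hK0 : K 0 = 0) (hKn : ∀ x, 0 ≤ K x) {f : ℝ → ℝ}
    (hf : MemLp f (ENNReal.ofReal p) μ) : Integrable (fun t => K (f t) ^ p) μ := by
  have h := (hK.comp_memLp hK0 hf).integrable_norm_rpow (by simp; linarith) (by simp)
  rw [ENNReal.toReal_ofReal (by linarith)] at h
  simpa [abs_of_nonneg (hKn _)] using h

/-- The energy of the positive part of the gradient. -/
def W0.posEnergy (u : W0 (Ioo (-T) T) p) : ℝ := ∫ t in Ioo (-T) T, max (u.grad t) 0 ^ p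

/-- The energy of the negative part of the gradient. -/
def W0.negEnergy (u : W0 (Ioo (-T) T) p) : ℝ := ∫ t in Ioo (-T) T, max (-u.grad t) 0 ^ p

lemma integral_Hab_rpow (hp : 1 < p) {a b : ℝ} (ha : 0 ≤ a) (hb : 0 ≤ b) {μ : Measure ℝ}
    {f : ℝ → ℝ} (hf : MemLp f (ENNReal.ofReal p) μ) :
    ∫ t, Hab a b (f t) ^ p ∂μ =
      a ^ p * ∫ t, max (f t) 0 ^ p ∂μ + b ^ p * ∫ t, max (-f t) 0 ^ p ∂μ := by
  simp only [Hab_rpow hp ha hb]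
  rw [integral_add ((integrable_rpow_comp hp lipschitz_posPart (by simp) (by simp) hf).const_mul _)
    ((integrable_rpow_comp hp lipschitz_negPart (by simp) (by simp) hf).const_mul _),
    integral_const_mul, integral_const_mul]

lemma energy_Hab (hp : 1 < p) {a b : ℝ} (ha : 0 ≤ a) (hb : 0 ≤ b) (u : W0 (Ioo (-T) T) p) :
    energy (Ioo (-T) T) p (Hab a b) u = a ^ p * u.posEnergy + b ^ p * u.negEnergy :=
  integral_Hab_rpow hp ha hb u.memLp_grad

lemma gsLevel_continuous (hp : 1 < p) : Continuous fun e => gsLevel p L T (a + e) (b + e) := by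
  unfold gsLevel gsFreq
  exact continuous_const.mul ((by fun_prop : Continuous fun e =>
    L * (a + e + (b + e)) / (2 * T)).rpow_const fun _ => Or.inr (by linarith))

/-- The sharp anisotropic Poincaré inequality on `W₀^{1,p}`. -/
lemma IsPSine.poincare (hw : IsPSine p L w) (hp : 1 < p) (hT : 0 < T)
    (ha : 0 ≤ a) (hb : 0 ≤ b) (u : W0 (Ioo (-T) T) p) :
    gsLevel p L T a b * ∫ t in Ioo (-T) T, |u.toFun t| ^ p ≤
      energy (Ioo (-T) T) p (Hab a b) u := by
  have hpos : ∀ {a b : ℝ}, 0 < a → 0 < b → gsLevel p L T a b * ∫ t in Ioo (-T) T, |u.toFun t| ^ p ≤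
      energy (Ioo (-T) T) p (Hab a b) u := by
    intro a b ha hb
    obtain ⟨φ, hφ, h1, h2⟩ := u.approx
    have t1 := (tendsto_integral_rpow_comp hp lipschitz_abs (by simp) (by simp) u.memLp_toFun
      (fun n => (hφ n).memLp _) h1).const_mul (gsLevel p L T a b)
    have t2 := (tendsto_integral_rpow_comp hp lipschitz_posPart (by simp) (by simp) u.memLp_grad
      (fun n => (hφ n).memLp_deriv _) h2).const_mul (a ^ p)
    have t3 := (tendsto_integral_rpow_comp hp lipschitz_negPart (by simp) (by simp) u.memLp_grad
      (fun n => (hφ n).memLp_deriv _) h2).const_mul (b ^ p)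
    rw [energy_Hab hp ha.le hb.le]
    refine le_of_tendsto_of_tendsto' t1 (t2.add t3) fun n => ?_
    rw [← integral_Hab_rpow hp ha.le hb.le ((hφ n).memLp_deriv _)]
    exact hw.poincare_testFun hp hT ha hb (hφ n)
  -- Degenerate `a` or `b`: apply the positive case to `a + e`, `b + e` and let `e` decrease to `0`.
  have hc1 : Continuous fun e => gsLevel p L T (a + e) (b + e) *
      ∫ t in Ioo (-T) T, |u.toFun t| ^ p :=
    (gsLevel_continuous hp).mul continuous_const
  have hc2 : Continuous fun e : ℝ => (a + e) ^ p * u.posEnergy + (b + e) ^ p * u.negEnergy :=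
    (((continuous_const.add continuous_id).rpow_const fun _ => Or.inr (by linarith)).mul
      continuous_const).add (((continuous_const.add continuous_id).rpow_const fun _ =>
        Or.inr (by linarith)).mul continuous_const)
  have h := le_of_tendsto_of_tendsto (b := 𝓝[>] (0 : ℝ)) (hc1.continuousWithinAt.tendsto)
    (hc2.continuousWithinAt.tendsto) (by
      filter_upwards [self_mem_nhdsWithin] with e he
      have he' : 0 < e := he
      have := hpos (a := a + e) (b := b + e) (by linarith) (by linarith)
      rwa [energy_Hab hp (by linarith) (by linarith)] at this)
  rw [energy_Hab hp ha hb]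
  simpa using h

end Picone

/-! ### The Euler–Lagrange equation and the value of the level -/

section Level

variable {p L T a b : ℝ} {w : ℝ → ℝ}

lemma memLp_of_continuous {f : ℝ → ℝ} (hf : Continuous f) (q : ENNReal) (c d : ℝ) :
    MemLp f q (volume.restrict (Ioo c d)) := by
  obtain ⟨B, hB⟩ := (isCompact_Icc (a := c) (b := d)).exists_bound_of_continuousOn hf.continuousOn
  refine MemLp.of_bound hf.aestronglyMeasurable B ?_
  filter_upwards [ae_restrict_mem measurableSet_Ioo] with t ht
  exact hB t (Ioo_subset_Icc_self ht)

lemma IsPSine.primitive_gsGrad (hw : IsPSine p L w) (hp : 1 < p) (hT : 0 < T)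
    (ha : 0 < a) (hb : 0 < b) {t : ℝ} (ht : t ∈ Icc (-T) T) :
    ∫ s in (-T)..t, gsGrad p w L T a b s = gsFun w L T a b t := by
  rw [integral_eq_of_hasDerivAt_off_countable_of_le (gsFun w L T a b) _ ht.1
    (countable_singleton (gsTop T a b)) hw.continuous_gsFun.continuousOn
    (fun x hx => hw.hasDerivAt_gsFun hp hT ha hb ⟨hx.1.1, hx.1.2.trans_le ht.2⟩ hx.2)
    ((hw.continuous_gsGrad hp).intervalIntegrable _ _), hw.gsFun_left_end hT ha hb, sub_zero]

lemma IsPSine.gsFlux_eq_primitive (hw : IsPSine p L w) (hp : 1 < p) (hT : 0 < T)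
    (ha : 0 < a) (hb : 0 < b) {t : ℝ} (ht : t ∈ Icc (-T) T) :
    gsFlux p w L T a b t = gsFlux p w L T a b (-T) -
      gsLevel p L T a b * ∫ s in (-T)..t, gsFun w L T a b s ^ (p - 1) := by
  have hc : Continuous fun s => gsFun w L T a b s ^ (p - 1) :=
    hw.continuous_gsFun.rpow_const fun _ => Or.inr (by linarith)
  have h := integral_eq_of_hasDerivAt_off_countable_of_le (gsFlux p w L T a b) _ ht.1
    (countable_singleton (gsTop T a b)) (hw.continuous_gsFlux hp).continuousOn
    (fun x hx => hw.hasDerivAt_gsFlux hp hT ha hb ⟨hx.1.1, hx.1.2.trans_le ht.2⟩ hx.2)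
    ((hc.const_mul _).neg.intervalIntegrable _ _)
  rw [intervalIntegral.integral_neg, intervalIntegral.integral_const_mul] at h
  rw [gsLevel]; linarith

lemma gsFun_right_end (hw : IsPSine p L w) (hT : 0 < T) (ha : 0 < a) (hb : 0 < b) :
    gsFun w L T a b T = 0 := by
  rw [← neg_neg T, gsFun_neg, neg_neg]; exact hw.gsFun_left_end hT hb ha

lemma IsPSine.gsGrad_ne_zero (hw : IsPSine p L w) (hp : 1 < p) (hT : 0 < T)
    (ha : 0 < a) (hb : 0 < b) {t : ℝ} (ht : t ∈ Ioo (-T) T) (hs : t ≠ gsTop T a b) :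
    gsGrad p w L T a b t ≠ 0 := by
  rcases hs.lt_or_gt with h | h
  · exact (hw.gsGrad_pos_left hp hT ha hb ⟨ht.1, h⟩).ne'
  · have := hw.gsGrad_pos_left (t := -t) hp hT hb ha
      ⟨by linarith [ht.2], by rw [gsTop_comm]; linarith⟩
    rw [gsGrad_neg] at this
    intro h0; rw [h0] at this; simp at this

lemma hasDerivAt_Hab_of_pos (a b : ℝ) {y : ℝ} (h : 0 < y) : HasDerivAt (Hab a b) a y := by
  have h1 : HasDerivAt (fun y : ℝ => a * y) a y := by
    simpa using (hasDerivAt_id y).const_mul a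
  refine h1.congr_of_eventuallyEq ?_
  filter_upwards [isOpen_Ioi.mem_nhds h] with x hx using Hab_of_pos a b (le_of_lt hx)

lemma hasDerivAt_Hab_of_neg (a b : ℝ) {y : ℝ} (h : y < 0) : HasDerivAt (Hab a b) (-b) y := by
  have h1 : HasDerivAt (fun y : ℝ => b * (-y)) (-b) y := by
    simpa using (hasDerivAt_id y).neg.const_mul b
  refine h1.congr_of_eventuallyEq ?_
  filter_upwards [isOpen_Iio.mem_nhds h] with x hx using Hab_of_neg a b (le_of_lt hx)

lemma rpow_sub_one_mul_self (hp : 1 < p) {c : ℝ} (hc : 0 ≤ c) : c ^ (p - 1) * c = c ^ p := by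
  rcases hc.eq_or_lt with h | h
  · rw [← h, Real.zero_rpow (by linarith : p ≠ 0), mul_zero]
  · rw [← Real.rpow_add_one h.ne', sub_add_cancel]

/-- The flux `H(y)^{p-1} H'(y)` for `H = H_{a,b}`. -/
lemma Hab_flux (hp : 1 < p) (ha : 0 ≤ a) (hb : 0 ≤ b) (y : ℝ) :
    Hab a b y ^ (p - 1) * deriv (Hab a b) y =
      a ^ p * max y 0 ^ (p - 1) - b ^ p * max (-y) 0 ^ (p - 1) := by
  have hp1 : p - 1 ≠ 0 := by linarith
  rcases lt_trichotomy y 0 with h | h | h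
  · rw [(hasDerivAt_Hab_of_neg a b h).deriv, Hab_of_neg a b h.le, max_eq_right h.le,
      max_eq_left (by linarith), Real.mul_rpow hb (by linarith), Real.zero_rpow hp1,
      ← rpow_sub_one_mul_self hp hb]
    ring
  -- At `y = 0` the value of `deriv` is irrelevant: the factor `0 ^ (p - 1)` vanishes because `p >
  -- 1`.
  · subst h; simp [Hab, Real.zero_rpow hp1]
  · rw [(hasDerivAt_Hab_of_pos a b h).deriv, Hab_of_pos a b h.le, max_eq_left h.le,
      max_eq_right (by linarith : -y ≤ 0), Real.mul_rpow ha h.le, Real.zero_rpow hp1,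
      ← rpow_sub_one_mul_self hp ha]
    ring

/-- Because `d v' = h ≥ 0` and `v' ≠ 0`, the sign of `v'` is that of the slope `d`, so `d` is
`H'(v')` and `h` is `H(v')`. -/
lemma IsPSine.flux_gsGrad (hw : IsPSine p L w) (hp : 1 < p) (hT : 0 < T)
    (ha : 0 < a) (hb : 0 < b) {t : ℝ} (ht : t ∈ Ioo (-T) T) (hs : t ≠ gsTop T a b) :
    Hab a b (gsGrad p w L T a b t) ^ (p - 1) * deriv (Hab a b) (gsGrad p w L T a b t) =
      gsFlux p w L T a b t := by
  obtain ⟨d, h, hd, h0, hF, hg⟩ := hw.exists_gs_slope hp hT ha hb hs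
  have hne := hw.gsGrad_ne_zero hp hT ha hb ht hs
  set g := gsGrad p w L T a b t
  rcases hd with rfl | rfl
  · have hg0 : 0 < g := by
      refine lt_of_le_of_ne ?_ hne.symm
      by_contra hcon
      nlinarith
    rw [(hasDerivAt_Hab_of_pos d b hg0).deriv, Hab_of_pos d b hg0.le, hF, hg]; ring
  · have hg0 : g < 0 := by
      refine lt_of_le_of_ne ?_ hne
      by_contra hcon
      nlinarith
    rw [(hasDerivAt_Hab_of_neg a b hg0).deriv, Hab_of_neg a b hg0.le, hF, ← hg]; ring_nf

lemma abs_rpow_sub_two_mul_of_nonneg (hp : 1 < p) {x : ℝ} (hx : 0 ≤ x) :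
    |x| ^ (p - 2) * x = x ^ (p - 1) := by
  rw [abs_of_nonneg hx]
  rcases hx.eq_or_lt with h | h
  · rw [← h, Real.zero_rpow (by linarith : p - 1 ≠ 0), mul_zero]
  · rw [← Real.rpow_add_one h.ne']; congr 1; ring

lemma ae_ne_restrict (s : ℝ) (A : Set ℝ) : ∀ᵐ t ∂(volume.restrict A), t ≠ s :=
  ae_restrict_of_ae (Measure.ae_ne volume s)

/-- The ground state satisfies the Euler–Lagrange equation. -/
lemma IsPSine.exists_groundState (hw : IsPSine p L w) (hp : 1 < p) (hT : 0 < T)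
    (ha : 0 < a) (hb : 0 < b) : ∃ u : W0 (Ioo (-T) T) p,
      u.grad = gsGrad p w L T a b ∧ (∀ t ∈ Ioo (-T) T, u.toFun t = gsFun w L T a b t) ∧
      ∀ φ : W0 (Ioo (-T) T) p, negLap (Ioo (-T) T) p (Hab a b) u φ =
        gsLevel p L T a b * ∫ t in Ioo (-T) T, |u.toFun t| ^ (p - 2) * u.toFun t * φ.toFun t := by
  have hr : T ∈ Icc (-T) T := ⟨by linarith, le_rfl⟩
  obtain ⟨u, hu, hu'⟩ := exists_W0_of_grad (g := gsGrad p w L T a b) hp hT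
    (memLp_of_continuous (hw.continuous_gsGrad hp) _ _ _)
    (by rw [hw.primitive_gsGrad hp hT ha hb hr, gsFun_right_end hw hT ha hb])
  have hu2 : ∀ t ∈ Ioo (-T) T, u.toFun t = gsFun w L T a b t := fun t ht => by
    rw [hu', ← hw.primitive_gsGrad hp hT ha hb (Ioo_subset_Icc_self ht)]
  refine ⟨u, hu, hu2, fun φ => ?_⟩
  have hc : Continuous fun s => gsFun w L T a b s ^ (p - 1) :=
    hw.continuous_gsFun.rpow_const fun _ => Or.inr (by linarith)
  have hφ0 : ∫ t in Ioo (-T) T, φ.grad t = 0 := by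
    rw [← intervalIntegral_eq_setIntegral_Ioo (by linarith)]; exact φ.rep_right hp hT
  have hφi := φ.integrableOn_grad hp
  have hibp := integral_primitive_mul hT (integrableOn_of_continuous hc (-T) T) hφi
    (φ.rep_right hp hT)
  have hMc : Continuous fun t => ∫ s in (-T)..t, gsFun w L T a b s ^ (p - 1) :=
    intervalIntegral.continuous_primitive (fun _ _ => hc.intervalIntegrable _ _) _
  have hMi : IntegrableOn (fun t => (∫ s in (-T)..t, gsFun w L T a b s ^ (p - 1)) * φ.grad t)
      (Ioo (-T) T) := by
    obtain ⟨B, hB⟩ := (isCompact_Icc (a := -T) (b := T)).exists_bound_of_continuousOn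
      hMc.continuousOn
    refine hφi.bdd_mul hMc.aestronglyMeasurable (c := B) ?_
    filter_upwards [ae_restrict_mem measurableSet_Ioo] with t ht
    exact hB t (Ioo_subset_Icc_self ht)
  -- The flux is a constant minus the level times a primitive of `v^{p-1}`. The constant drops out
  -- because `φ'` has mean zero, and the primitive is integrated by parts.
  calc negLap (Ioo (-T) T) p (Hab a b) u φ
      = ∫ t in Ioo (-T) T, (gsFlux p w L T a b (-T) * φ.grad t - gsLevel p L T a b *
          ((∫ s in (-T)..t, gsFun w L T a b s ^ (p - 1)) * φ.grad t)) := by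
        refine integral_congr_ae ?_
        filter_upwards [ae_restrict_mem measurableSet_Ioo, ae_ne_restrict (gsTop T a b) _]
          with t ht hs
        rw [hu, hw.flux_gsGrad hp hT ha hb ht hs,
          hw.gsFlux_eq_primitive hp hT ha hb (Ioo_subset_Icc_self ht)]
        ring
    _ = gsLevel p L T a b * ∫ t in Ioo (-T) T,
          gsFun w L T a b t ^ (p - 1) * ∫ s in (-T)..t, φ.grad s := by
        rw [integral_sub (hφi.const_mul _) (hMi.const_mul _), integral_const_mul,
          integral_const_mul, hφ0, hibp]
        ring
    _ = _ := by
        congr 1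
        refine integral_congr_ae ?_
        filter_upwards [ae_restrict_mem measurableSet_Ioo, φ.ae_eq_rep hp hT] with t ht h2
        rw [hu2 t ht, h2, abs_rpow_sub_two_mul_of_nonneg hp (hw.gsFun_pos hT ha hb ht).le]
        rfl

/-- Euler's relation `H'(y) y = H(y)` for a `1`-homogeneous function. -/
lemma negLap_Hab_self (hp : 1 < p) (ha : 0 ≤ a) (hb : 0 ≤ b) (u : W0 (Ioo (-T) T) p) :
    negLap (Ioo (-T) T) p (Hab a b) u u = energy (Ioo (-T) T) p (Hab a b) u := by
  refine integral_congr_ae (Eventually.of_forall fun t => ?_)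
  simp only [Hab_flux hp ha hb, Hab_rpow hp ha hb]
  have hp0 : p - 1 ≠ 0 := by linarith
  rcases le_total 0 (u.grad t) with h | h
  · rw [max_eq_left h, max_eq_right (by linarith : -u.grad t ≤ 0), Real.zero_rpow hp0,
      Real.zero_rpow (by linarith : p ≠ 0), ← rpow_sub_one_mul_self hp h]; ring
  · rw [max_eq_right h, max_eq_left (by linarith : 0 ≤ -u.grad t), Real.zero_rpow hp0,
      Real.zero_rpow (by linarith : p ≠ 0),
      ← rpow_sub_one_mul_self hp (by linarith : 0 ≤ -u.grad t)]; ring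

lemma gsLevel_pos (hp : 1 < p) (hL : 0 < L) (hT : 0 < T) (hab : 0 < a + b) :
    0 < gsLevel p L T a b := by
  have : 0 < p - 1 := by linarith
  unfold gsLevel gsFreq; positivity

lemma W0.exists_smul (hp : 1 < p) (hT : 0 < T) (u : W0 (Ioo (-T) T) p) (c : ℝ) :
    ∃ v : W0 (Ioo (-T) T) p, (v.grad = fun t => c * u.grad t) ∧
      v.toFun =ᵐ[volume.restrict (Ioo (-T) T)] fun t => c * u.toFun t := by
  obtain ⟨v, hv, hv'⟩ := exists_W0_of_grad hp hT (u.memLp_grad.const_mul c)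
    (by
      have h : ∫ s in (-T)..T, u.grad s = 0 := u.rep_right hp hT
      rw [intervalIntegral.integral_const_mul, h, mul_zero])
  refine ⟨v, hv, ?_⟩
  filter_upwards [u.ae_eq_rep hp hT] with t ht
  rw [hv', ht, W0.rep, ← intervalIntegral.integral_const_mul]

lemma abs_rpow_sub_two_mul_self (hp : 1 < p) (x : ℝ) : |x| ^ (p - 2) * x * x = |x| ^ p := by
  rcases eq_or_ne x 0 with h | h
  · rw [h, abs_zero, Real.zero_rpow (by linarith : p ≠ 0), mul_zero]
  · rw [mul_assoc, ← abs_mul_abs_self x, ← mul_assoc, ← Real.rpow_add_one (abs_ne_zero.2 h),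
      ← Real.rpow_add_one (abs_ne_zero.2 h)]
    congr 1; ring

/-- Testing the equation with the ground state itself gives energy equal to level times `N`, the
`p`-th power of its norm; scaling by `N^{-1/p}` preserves this ratio. -/
lemma IsPSine.exists_normalized_groundState (hw : IsPSine p L w) (hp : 1 < p) (hT : 0 < T)
    (ha : 0 < a) (hb : 0 < b) : ∃ u : W0 (Ioo (-T) T) p, lpNormOn (Ioo (-T) T) p u.toFun = 1 ∧
      energy (Ioo (-T) T) p (Hab a b) u = gsLevel p L T a b := by
  have hp0 : 0 < p := by linarith
  obtain ⟨u, hu, hu2, hu3⟩ := hw.exists_groundState hp hT ha hb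
  have hE : energy (Ioo (-T) T) p (Hab a b) u =
      gsLevel p L T a b * ∫ t in Ioo (-T) T, |u.toFun t| ^ p := by
    rw [← negLap_Hab_self hp ha.le hb.le, hu3 u]
    simp only [abs_rpow_sub_two_mul_self hp]
  set N := ∫ t in Ioo (-T) T, |u.toFun t| ^ p with hN
  have hNpos : 0 < N := by
    have h1 : N = ∫ t in (-T)..T, gsFun w L T a b t ^ p := by
      rw [intervalIntegral_eq_setIntegral_Ioo (by linarith)]
      refine setIntegral_congr_fun measurableSet_Ioo fun t ht => ?_
      simp only [hu2 t ht, abs_of_pos (hw.gsFun_pos hT ha hb ht)]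
    rw [h1]
    refine intervalIntegral.intervalIntegral_pos_of_pos_on
      ((hw.continuous_gsFun.rpow_const fun _ => Or.inr hp0.le).intervalIntegrable _ _)
      (fun t ht => Real.rpow_pos_of_pos (hw.gsFun_pos hT ha hb ht) _) (by linarith)
  set c := N ^ (-(1 / p)) with hc
  have hc0 : 0 < c := Real.rpow_pos_of_pos hNpos _
  have hcN : c ^ p * N = 1 := by
    rw [hc, ← Real.rpow_mul hNpos.le, show -(1 / p) * p = -1 by field_simp, Real.rpow_neg_one,
      inv_mul_cancel₀ hNpos.ne']
  obtain ⟨v, hv, hv'⟩ := u.exists_smul hp hT c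
  refine ⟨v, ?_, ?_⟩
  · have h1 : ∫ t in Ioo (-T) T, |v.toFun t| ^ p = 1 := by
      rw [← hcN, hN, ← integral_const_mul]
      refine integral_congr_ae ?_
      filter_upwards [hv'] with t ht
      rw [ht, abs_mul, abs_of_pos hc0, Real.mul_rpow hc0.le (abs_nonneg _)]
    rw [lpNormOn, h1, Real.one_rpow]
  · have h1 : energy (Ioo (-T) T) p (Hab a b) v = c ^ p * energy (Ioo (-T) T) p (Hab a b) u := by
      rw [energy, energy, ← integral_const_mul]
      refine integral_congr_ae (Eventually.of_forall fun t => ?_)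
      simp only [hv]
      rw [← Real.mul_rpow hc0.le (Hab_nonneg ha.le hb.le _)]
      congr 1
      rcases le_total 0 (u.grad t) with h | h
      · rw [Hab_of_pos a b h, Hab_of_pos a b (by positivity)]; ring
      · rw [Hab_of_neg a b h, Hab_of_neg a b (by nlinarith)]; ring
    rw [h1, hE, mul_left_comm, hcN, mul_one]

lemma W0.posEnergy_nonneg (u : W0 (Ioo (-T) T) p) : 0 ≤ u.posEnergy :=
  integral_nonneg fun t => by positivity

lemma W0.negEnergy_nonneg (u : W0 (Ioo (-T) T) p) : 0 ≤ u.negEnergy :=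
  integral_nonneg fun t => by positivity

/-- The explicit value of the least energy level. -/
lemma IsPSine.level_Hab (hw : IsPSine p L w) (hp : 1 < p) (hT : 0 < T)
    (ha : 0 ≤ a) (hb : 0 ≤ b) : level (Ioo (-T) T) p (Hab a b) = gsLevel p L T a b := by
  have hp0 : 0 < p := by linarith
  have hlow : ∀ u : W0 (Ioo (-T) T) p, lpNormOn (Ioo (-T) T) p u.toFun = 1 →
      gsLevel p L T a b ≤ energy (Ioo (-T) T) p (Hab a b) u := by
    intro u hu
    have h1 : ∫ t in Ioo (-T) T, |u.toFun t| ^ p = 1 := by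
      have h2 : 0 ≤ ∫ t in Ioo (-T) T, |u.toFun t| ^ p := integral_nonneg fun t => by positivity
      have h3 := congrArg (· ^ p) hu
      simp only [lpNormOn] at h3
      rwa [← Real.rpow_mul h2, one_div_mul_cancel hp0.ne', Real.rpow_one, Real.one_rpow] at h3
    have := hw.poincare hp hT ha hb u
    rwa [h1, mul_one] at this
  refine le_antisymm ?_ (le_csInf ?_ ?_)
  -- A minimiser may not exist when `a` or `b` vanishes. The ground state for `a + e`, `b + e`
  -- serves as competitor: its energy only drops when the coefficients are lowered to `a`, `b`.
  · have hc := (gsLevel_continuous (L := L) (T := T) (a := a) (b := b) hp).continuousWithinAt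
      (s := Ioi 0) (x := 0)
    have h := ge_of_tendsto (b := level (Ioo (-T) T) p (Hab a b)) hc.tendsto (by
      filter_upwards [self_mem_nhdsWithin] with e he
      have he' : 0 < e := he
      obtain ⟨u, hu, hE⟩ := hw.exists_normalized_groundState (a := a + e) (b := b + e) hp hT
        (by linarith) (by linarith)
      have h1 : level (Ioo (-T) T) p (Hab a b) ≤ energy (Ioo (-T) T) p (Hab a b) u :=
        csInf_le ⟨gsLevel p L T a b, by rintro x ⟨v, hv, rfl⟩; exact hlow v hv⟩ ⟨u, hu, rfl⟩
      rw [← hE]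
      refine h1.trans ?_
      rw [energy_Hab hp ha hb, energy_Hab hp (by linarith) (by linarith)]
      have := u.posEnergy_nonneg
      have := u.negEnergy_nonneg
      gcongr <;> linarith)
    simpa using h
  · obtain ⟨u, hu, -⟩ := hw.exists_normalized_groundState (a := 1) (b := 1) hp hT
      one_pos one_pos
    exact ⟨_, u, hu, rfl⟩
  · rintro x ⟨u, hu, rfl⟩
    exact hlow u hu

/-- For `a, b > 0` the least energy level is a fundamental frequency. -/
lemma IsPSine.isFundamentalFrequency (hw : IsPSine p L w) (hp : 1 < p) (hT : 0 < T)
    (ha : 0 < a) (hb : 0 < b) : IsFundamentalFrequency (Ioo (-T) T) p (Hab a b) := by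
  obtain ⟨u, hu, hu2, hu3⟩ := hw.exists_groundState hp hT ha hb
  refine ⟨u, fun h => ?_, ?_, ?_, fun φ => ?_⟩
  · have h1 : ∀ᵐ t ∂(volume.restrict (Ioo (-T) T)), False := by
      filter_upwards [h, ae_restrict_mem measurableSet_Ioo] with t h1 h2
      have := hw.gsFun_pos hT ha hb h2
      rw [← hu2 t h2, h1] at this
      exact lt_irrefl _ this
    rw [eventually_false_iff_eq_bot, ae_eq_bot, Measure.restrict_eq_zero, Real.volume_Ioo] at h1
    simp at h1; linarith
  · filter_upwards [ae_restrict_mem measurableSet_Ioo, ae_ne_restrict (gsTop T a b) _] with t ht hs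
    rw [hu]
    rcases (hw.gsGrad_ne_zero hp hT ha hb ht hs).lt_or_gt with h | h
    · exact (hasDerivAt_Hab_of_neg a b h).differentiableAt
    · exact (hasDerivAt_Hab_of_pos a b h).differentiableAt
  · exact (measurable_deriv _).comp_aemeasurable u.memLp_grad.aestronglyMeasurable.aemeasurable
  · rw [hu3 φ, hw.level_Hab hp hT ha.le hb.le]

end Level

/-! ### No eigenfunction in the degenerate case -/

section Nonexistence

variable {p L T a b : ℝ} {w : ℝ → ℝ}

/-- The lemma of du Bois-Reymond in `W₀^{1,p}`. -/
lemma ae_eq_const_of_integral_mul_grad_eq_zero (hp : 1 < p) (hT : 0 < T) {K : ℝ → ℝ}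
    (hK : IntegrableOn K (Ioo (-T) T))
    (h : ∀ φ : W0 (Ioo (-T) T) p, ∫ t in Ioo (-T) T, K t * φ.grad t = 0) :
    ∃ C : ℝ, K =ᵐ[volume.restrict (Ioo (-T) T)] fun _ => C := by
  set μ := volume.restrict (Ioo (-T) T) with hμ
  have hμu : μ.real univ = 2 * T := by
    rw [hμ, Measure.real, Measure.restrict_apply_univ, Real.volume_Ioo,
      ENNReal.toReal_ofReal (by linarith)]
    ring
  refine ⟨(∫ t, K t ∂μ) / (2 * T), ?_⟩
  refine Integrable.ae_eq_of_forall_setIntegral_eq _ _ hK (integrable_const _) fun E hE _ => ?_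
  -- The test gradient is the indicator of `E` minus its mean `m`, so that it has a primitive in the
  -- Sobolev space.
  set m := μ.real E / (2 * T) with hm
  have hind : MemLp (E.indicator fun _ : ℝ => (1 : ℝ)) (ENNReal.ofReal p) μ :=
    (memLp_const 1).indicator hE
  have hgm : MemLp (fun t => E.indicator (fun _ : ℝ => (1 : ℝ)) t - m) (ENNReal.ofReal p) μ :=
    hind.sub (memLp_const m)
  have hIi : Integrable (E.indicator fun _ : ℝ => (1 : ℝ)) μ := (integrable_const 1).indicator hE
  obtain ⟨φ, hφ, -⟩ := exists_W0_of_grad hp hT hgm (by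
    rw [intervalIntegral_eq_setIntegral_Ioo (by linarith), integral_sub hIi (integrable_const m),
      integral_indicator hE, setIntegral_const, integral_const, hμu, hm]
    simp only [smul_eq_mul, mul_one]
    field_simp; ring)
  have h1 := h φ
  rw [hφ] at h1
  have h2 : ∀ t, K t * (E.indicator (fun _ : ℝ => (1 : ℝ)) t - m) =
      E.indicator K t - m * K t := fun t => by
    by_cases ht : t ∈ E <;> simp [ht] <;> ring
  simp only [h2] at h1
  rw [integral_sub (hK.indicator hE) (hK.const_mul m), integral_indicator hE,
    integral_const_mul] at h1
  rw [setIntegral_const, smul_eq_mul]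
  have h3 : ∫ t in E, K t ∂μ = m * ∫ t, K t ∂μ := by linarith
  rw [h3, hm]; ring

lemma abs_rpow_sub_two_mul (hp : 1 < p) (x : ℝ) :
    |x| ^ (p - 2) * x = max x 0 ^ (p - 1) - max (-x) 0 ^ (p - 1) := by
  have hp1 : p - 1 ≠ 0 := by linarith
  rcases le_total 0 x with h | h
  · rw [abs_rpow_sub_two_mul_of_nonneg hp h, max_eq_left h, max_eq_right (by linarith : -x ≤ 0),
      Real.zero_rpow hp1, sub_zero]
  · rw [max_eq_right h, max_eq_left (by linarith : 0 ≤ -x), Real.zero_rpow hp1, zero_sub,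
      ← abs_rpow_sub_two_mul_of_nonneg hp (by linarith : 0 ≤ -x), abs_neg]
    ring

/-- For `p < 2` the factor `|x|^{p-2}` is singular at the origin; written with the positive and
negative parts, only the positive exponent `p - 1` appears. -/
lemma continuous_abs_rpow_sub_two_mul (hp : 1 < p) : Continuous fun x : ℝ => |x| ^ (p - 2) * x := by
  simp only [abs_rpow_sub_two_mul hp]
  exact ((continuous_id.max continuous_const).rpow_const fun _ => Or.inr (by linarith)).sub
    ((continuous_neg.max continuous_const).rpow_const fun _ => Or.inr (by linarith))

lemma integrable_posPart_rpow (hp : 1 < p) (u : W0 (Ioo (-T) T) p) :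
    IntegrableOn (fun t => max (u.grad t) 0 ^ (p - 1)) (Ioo (-T) T) := by
  have h1 := integrable_rpow_comp hp lipschitz_posPart (by simp) (by simp) u.memLp_grad
  have h2 : AEMeasurable u.grad (volume.restrict (Ioo (-T) T)) :=
    u.memLp_grad.aestronglyMeasurable.aemeasurable
  refine Integrable.mono' ((integrable_const 1).add h1)
    ((h2.max aemeasurable_const).pow_const (p - 1)).aestronglyMeasurable
    (Eventually.of_forall fun t => ?_)
  rw [Real.norm_of_nonneg (by positivity)]
  simp only [Pi.add_apply]
  set y := max (u.grad t) 0
  have hy : 0 ≤ y := le_max_right _ _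
  rcases le_total y 1 with h | h
  · have := Real.rpow_le_one hy h (by linarith : 0 ≤ p - 1)
    have := Real.rpow_nonneg hy p
    linarith
  · have := Real.rpow_le_rpow_of_exponent_le h (by linarith : p - 1 ≤ p)
    linarith

lemma integrableOn_posPart_rpow_mul_grad (hp : 1 < p) (u φ : W0 (Ioo (-T) T) p) :
    IntegrableOn (fun t => max (u.grad t) 0 ^ (p - 1) * φ.grad t) (Ioo (-T) T) := by
  have h1 := integrable_rpow_comp hp lipschitz_posPart (by simp) (by simp) u.memLp_grad
  have h2 := integrable_rpow_comp hp lipschitz_abs (by simp) (by simp) φ.memLp_grad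
  have h3 : AEMeasurable u.grad (volume.restrict (Ioo (-T) T)) :=
    u.memLp_grad.aestronglyMeasurable.aemeasurable
  refine Integrable.mono' ((h1.const_mul (p - 1)).add h2)
    (((h3.max aemeasurable_const).pow_const (p - 1)).aestronglyMeasurable.mul
      φ.memLp_grad.aestronglyMeasurable) (Eventually.of_forall fun t => ?_)
  have h4 := young_rpow hp (le_max_right (u.grad t) 0) (abs_nonneg (φ.grad t))
  have h5 : 0 ≤ max (u.grad t) 0 ^ (p - 1) := by positivity
  rw [norm_mul, Real.norm_of_nonneg h5, Real.norm_eq_abs]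
  have h6 : 0 ≤ (p - 1) * (max (u.grad t) 0 ^ (p - 1) * |φ.grad t|) :=
    mul_nonneg (by linarith) (by positivity)
  simp only [Pi.add_apply]
  linarith

/-- If the flux is a multiple of `(u'^+)^{p-1}`, then a continuous function agrees with it almost
everywhere whose derivative is `-l |u|^{p-2} u`. -/
lemma exists_continuous_flux (hp : 1 < p) (hT : 0 < T) {c l : ℝ} (u : W0 (Ioo (-T) T) p)
    (h : ∀ φ : W0 (Ioo (-T) T) p, ∫ t in Ioo (-T) T, c * max (u.grad t) 0 ^ (p - 1) * φ.grad t =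
      l * ∫ t in Ioo (-T) T, |u.toFun t| ^ (p - 2) * u.toFun t * φ.toFun t) :
    ∃ F : ℝ → ℝ, (∀ t ∈ Ioo (-T) T, HasDerivAt F (-(l * (|u.rep t| ^ (p - 2) * u.rep t))) t) ∧
      ∀ᵐ t ∂(volume.restrict (Ioo (-T) T)), c * max (u.grad t) 0 ^ (p - 1) = F t := by
  set m : ℝ → ℝ := fun t => |u.rep t| ^ (p - 2) * u.rep t with hm
  have hmc : ContinuousOn m (Icc (-T) T) :=
    (continuous_abs_rpow_sub_two_mul hp).comp_continuousOn (u.continuousOn_rep hp hT)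
  have hmi : IntegrableOn m (Ioo (-T) T) :=
    hmc.integrableOn_Icc.mono_set Ioo_subset_Icc_self
  have hMc := continuousOn_primitive_Icc hT hmi
  set M : ℝ → ℝ := fun t => ∫ s in (-T)..t, m s with hM
  have hMi : ∀ φ : W0 (Ioo (-T) T) p, IntegrableOn (fun t => M t * φ.grad t) (Ioo (-T) T) := by
    intro φ
    obtain ⟨B, hB⟩ := (isCompact_Icc (a := -T) (b := T)).exists_bound_of_continuousOn hMc
    refine (φ.integrableOn_grad hp).bdd_mul (c := B)
      ((hMc.mono Ioo_subset_Icc_self).aestronglyMeasurable measurableSet_Ioo) ?_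
    filter_upwards [ae_restrict_mem measurableSet_Ioo] with t ht
    exact hB t (Ioo_subset_Icc_self ht)
  have hFi := (integrable_posPart_rpow hp u).const_mul c
  have hK : IntegrableOn (fun t => c * max (u.grad t) 0 ^ (p - 1) + l * M t) (Ioo (-T) T) :=
    hFi.add ((hMc.integrableOn_Icc.mono_set Ioo_subset_Icc_self).const_mul l)
  -- Integrating the right side of the equation by parts shows that flux plus `l * M` annihilates
  -- every gradient, hence is constant.
  obtain ⟨C, hC⟩ := ae_eq_const_of_integral_mul_grad_eq_zero hp hT hK (fun φ => by
    have hibp := integral_primitive_mul hT hmi (φ.integrableOn_grad hp) (φ.rep_right hp hT)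
    have e1 : ∫ t in Ioo (-T) T, |u.toFun t| ^ (p - 2) * u.toFun t * φ.toFun t =
        ∫ t in Ioo (-T) T, m t * ∫ s in (-T)..t, φ.grad s := by
      refine integral_congr_ae ?_
      filter_upwards [u.ae_eq_rep hp hT, φ.ae_eq_rep hp hT] with t h1 h2
      rw [h1, h2]; rfl
    have hint := (integrableOn_posPart_rpow_mul_grad hp u φ).const_mul c
    simp only [← mul_assoc] at hint
    have e2 : ∫ t in Ioo (-T) T, (c * max (u.grad t) 0 ^ (p - 1) + l * M t) * φ.grad t =
        ∫ t in Ioo (-T) T, (c * max (u.grad t) 0 ^ (p - 1) * φ.grad t +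
          l * (M t * φ.grad t)) :=
      integral_congr_ae (Eventually.of_forall fun t => by ring)
    rw [e2, integral_add hint ((hMi φ).const_mul l), h φ, integral_const_mul, e1, hibp]
    ring)
  refine ⟨fun t => C - l * M t, fun t ht => ?_, ?_⟩
  · have hd : HasDerivAt M (m t) t := by
      refine intervalIntegral.integral_hasDerivAt_right
        (intervalIntegrable_of_integrableOn_Ioo hmi ⟨le_rfl, by linarith⟩ (Ioo_subset_Icc_self ht))
        ?_ (hmc.continuousAt (Icc_mem_nhds ht.1 ht.2))
      exact (hmc.mono Ioo_subset_Icc_self).stronglyMeasurableAtFilter isOpen_Ioo t ht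
    simpa using (hd.const_mul l).const_sub C
  · filter_upwards [hC] with t ht
    linarith

lemma W0.rep_lt_rep (hp : 1 < p) (u : W0 (Ioo (-T) T) p) {x y : ℝ} (hx : -T ≤ x) (hxy : x < y)
    (hy : y ≤ T) (hpos : ∀ᵐ t ∂(volume.restrict (Ioo x y)), 0 < u.grad t) :
    u.rep x < u.rep y := by
  have hx' : x ∈ Icc (-T) T := ⟨hx, hxy.le.trans hy⟩
  have hy' : y ∈ Icc (-T) T := ⟨hx.trans hxy.le, hy⟩
  have hl' : (-T) ∈ Icc (-T) T := ⟨le_rfl, by linarith⟩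
  have hg := u.integrableOn_grad hp
  have h1 : u.rep y - u.rep x = ∫ t in x..y, u.grad t :=
    intervalIntegral.integral_interval_sub_left
      (intervalIntegrable_of_integrableOn_Ioo hg hl' hy')
      (intervalIntegrable_of_integrableOn_Ioo hg hl' hx')
  rw [← sub_pos, h1, intervalIntegral_eq_setIntegral_Ioo hxy.le]
  refine lt_of_le_of_ne (integral_nonneg_of_ae (hpos.mono fun t ht => ht.le)) fun h0 => ?_
  rw [eq_comm, integral_eq_zero_iff_of_nonneg_ae (hpos.mono fun t ht => ht.le)
    (hg.mono_set (Ioo_subset_Ioo hx hy))] at h0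
  have h2 : ∀ᵐ t ∂(volume.restrict (Ioo x y)), False := by
    filter_upwards [hpos, h0] with t h3 h4
    rw [h4] at h3; exact lt_irrefl _ h3
  rw [eventually_false_iff_eq_bot, ae_eq_bot, Measure.restrict_eq_zero, Real.volume_Ioo] at h2
  simp at h2; linarith

/-- A one-sided degenerate flux admits no non-trivial eigenfunction. -/
lemma ae_eq_zero_of_degenerate_flux (hp : 1 < p) (hT : 0 < T) {c l : ℝ} (hc : 0 ≤ c) (hl : 0 < l)
    (u : W0 (Ioo (-T) T) p)
    (h : ∀ φ : W0 (Ioo (-T) T) p, ∫ t in Ioo (-T) T, c * max (u.grad t) 0 ^ (p - 1) * φ.grad t =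
      l * ∫ t in Ioo (-T) T, |u.toFun t| ^ (p - 2) * u.toFun t * φ.toFun t) :
    u.toFun =ᵐ[volume.restrict (Ioo (-T) T)] 0 := by
  obtain ⟨F, hF, hFe⟩ := exists_continuous_flux hp hT u h
  have hFc : ContinuousOn F (Ioo (-T) T) := fun t ht => (hF t ht).continuousAt.continuousWithinAt
  -- `F` is continuous and almost everywhere equal to a non-negative function.
  have hF0 : ∀ t ∈ Ioo (-T) T, 0 ≤ F t := by
    intro t ht
    by_contra! hcon
    have h1 : ∀ᶠ s in 𝓝 t, s ∈ Ioo (-T) T ∧ F s < 0 :=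
      (isOpen_Ioo.eventually_mem ht).and ((hF t ht).continuousAt.eventually_lt_const hcon)
    obtain ⟨x, y, hxy, hsub⟩ := mem_nhds_iff_exists_Ioo_subset.1 h1
    have h2 : ∀ᵐ s ∂(volume.restrict (Ioo x y)), False := by
      have h3 : volume.restrict (Ioo x y) ≤ volume.restrict (Ioo (-T) T) :=
        Measure.restrict_mono (fun s hs => (hsub hs).1) le_rfl
      filter_upwards [ae_mono h3 hFe, ae_restrict_mem measurableSet_Ioo] with s hs hm
      have h4 := (hsub hm).2
      have : 0 ≤ c * max (u.grad s) 0 ^ (p - 1) := by positivity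
      linarith
    rw [eventually_false_iff_eq_bot, ae_eq_bot, Measure.restrict_eq_zero, Real.volume_Ioo] at h2
    simp at h2; linarith [hxy.1, hxy.2]
  -- A zero of `F` would be a minimum, but `F' t ≠ 0` where `u.rep t ≠ 0`. So `F > 0` near `t`,
  -- which forces `u' > 0` almost everywhere there: `u.rep` increases strictly through `t`, which is
  -- neither a maximum nor a minimum point.
  have key : ∀ t ∈ Ioo (-T) T, u.rep t ≠ 0 → ∃ x ∈ Icc (-T) T, ∃ y ∈ Icc (-T) T,
      u.rep x < u.rep t ∧ u.rep t < u.rep y := by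
    intro t ht h0
    have hFt : 0 < F t := by
      refine lt_of_le_of_ne (hF0 t ht) fun h1 => ?_
      have hmin : IsLocalMin F t := by
        filter_upwards [isOpen_Ioo.mem_nhds ht] with s hs
        rw [← h1]; exact hF0 s hs
      have h2 := hmin.hasDerivAt_eq_zero (hF t ht)
      have h3 : |u.rep t| ^ (p - 2) * u.rep t ≠ 0 :=
        mul_ne_zero (Real.rpow_pos_of_pos (abs_pos.2 h0) _).ne' h0
      exact (neg_ne_zero.2 (mul_ne_zero hl.ne' h3)) h2
    have h1 : ∀ᶠ s in 𝓝 t, s ∈ Ioo (-T) T ∧ 0 < F s :=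
      (isOpen_Ioo.eventually_mem ht).and ((hF t ht).continuousAt.eventually_const_lt hFt)
    obtain ⟨x, y, hxy, hsub⟩ := mem_nhds_iff_exists_Ioo_subset.1 h1
    have hgpos : ∀ᵐ s ∂(volume.restrict (Ioo x y)), 0 < u.grad s := by
      have h3 : volume.restrict (Ioo x y) ≤ volume.restrict (Ioo (-T) T) :=
        Measure.restrict_mono (fun s hs => (hsub hs).1) le_rfl
      filter_upwards [ae_mono h3 hFe, ae_restrict_mem measurableSet_Ioo] with s hs hm
      by_contra! hcon
      have h4 := (hsub hm).2
      rw [← hs, max_eq_right hcon, Real.zero_rpow (by linarith), mul_zero] at h4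
      exact lt_irrefl _ h4
    have hx' : (x + t) / 2 ∈ Ioo x y := ⟨by linarith [hxy.1], by linarith [hxy.1, hxy.2]⟩
    have hy' : (t + y) / 2 ∈ Ioo x y := ⟨by linarith [hxy.1, hxy.2], by linarith [hxy.2]⟩
    refine ⟨(x + t) / 2, Ioo_subset_Icc_self (hsub hx').1, (t + y) / 2,
      Ioo_subset_Icc_self (hsub hy').1, ?_, ?_⟩
    · exact u.rep_lt_rep hp (hsub hx').1.1.le (by linarith [hxy.1]) ht.2.le
        (ae_mono (Measure.restrict_mono (Ioo_subset_Ioo hx'.1.le hxy.2.le) le_rfl) hgpos)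
    · exact u.rep_lt_rep hp ht.1.le (by linarith [hxy.2]) (hsub hy').1.2.le
        (ae_mono (Measure.restrict_mono (Ioo_subset_Ioo hxy.1.le hy'.2.le) le_rfl) hgpos)
  have hne : (Icc (-T) T).Nonempty := ⟨-T, le_rfl, by linarith⟩
  have hint : ∀ t ∈ Icc (-T) T, u.rep t ≠ 0 → t ∈ Ioo (-T) T := by
    intro t ht h0
    refine ⟨lt_of_le_of_ne ht.1 ?_, lt_of_le_of_ne ht.2 ?_⟩
    · rintro rfl; exact h0 u.rep_left
    · rintro rfl; exact h0 (u.rep_right hp hT)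
  obtain ⟨x, hx, hxm⟩ := isCompact_Icc.exists_isMaxOn hne (u.continuousOn_rep hp hT)
  obtain ⟨y, hy, hym⟩ := isCompact_Icc.exists_isMinOn hne (u.continuousOn_rep hp hT)
  have hx0 : u.rep x = 0 := by
    by_contra h0
    obtain ⟨-, -, z, hz, -, h1⟩ := key x (hint x hx h0) h0
    exact absurd (hxm hz) (not_le.2 h1)
  have hy0 : u.rep y = 0 := by
    by_contra h0
    obtain ⟨z, hz, -, -, h1, -⟩ := key y (hint y hy h0) h0
    exact absurd (hym hz) (not_le.2 h1)
  filter_upwards [u.ae_eq_rep hp hT, ae_restrict_mem measurableSet_Ioo] with t h1 h2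
  have h3 : u.rep t ≤ u.rep x := hxm (Ioo_subset_Icc_self h2)
  have h4 : u.rep y ≤ u.rep t := hym (Ioo_subset_Icc_self h2)
  rw [h1, Pi.zero_apply]
  linarith

lemma IsPSine.not_isFundamentalFrequency_left (hw : IsPSine p L w) (hp : 1 < p) (hT : 0 < T)
    (ha : 0 < a) : ¬ IsFundamentalFrequency (Ioo (-T) T) p (Hab a 0) := by
  rintro ⟨u, hu, -, -, h⟩
  refine hu (ae_eq_zero_of_degenerate_flux hp hT (Real.rpow_nonneg ha.le p)
    (gsLevel_pos (b := 0) hp hw.pos hT (by linarith)) u fun φ => ?_)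
  rw [← hw.level_Hab hp hT ha.le le_rfl, ← h φ, negLap]
  simp only [Hab_flux hp ha.le le_rfl, Real.zero_rpow (by linarith : p ≠ 0), zero_mul, sub_zero]

/-- If `u` is an eigenfunction for `H_{0,b}`, then `-u` solves the equation whose flux uses the
positive part of the gradient. -/
lemma IsPSine.not_isFundamentalFrequency_right (hw : IsPSine p L w) (hp : 1 < p) (hT : 0 < T)
    (hb : 0 < b) : ¬ IsFundamentalFrequency (Ioo (-T) T) p (Hab 0 b) := by
  rintro ⟨u, hu, -, -, h⟩
  obtain ⟨v, hv, hv'⟩ := u.exists_smul hp hT (-1)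
  refine hu ?_
  have hv0 := ae_eq_zero_of_degenerate_flux hp hT (Real.rpow_nonneg hb.le p)
    (gsLevel_pos (a := 0) hp hw.pos hT (by linarith)) v fun φ => (by
      have h1 := h φ
      rw [hw.level_Hab hp hT le_rfl hb.le, negLap] at h1
      simp only [Hab_flux hp le_rfl hb.le, Real.zero_rpow (by linarith : p ≠ 0), zero_mul,
        zero_sub, neg_mul, integral_neg] at h1
      have e1 : ∫ t in Ioo (-T) T, |v.toFun t| ^ (p - 2) * v.toFun t * φ.toFun t =
          -∫ t in Ioo (-T) T, |u.toFun t| ^ (p - 2) * u.toFun t * φ.toFun t := by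
        rw [← integral_neg]
        refine integral_congr_ae ?_
        filter_upwards [hv'] with t ht
        rw [ht, neg_one_mul, abs_neg]; ring
      rw [e1, mul_neg, ← h1, neg_neg]
      simp only [hv, neg_one_mul])
  filter_upwards [hv', hv0] with t h1 h2
  rw [h1] at h2
  simpa using h2

end Nonexistence

/-! ### The class of operators, the optimal constants and the equality cases -/

section Class

variable {p L T a b : ℝ} {w : ℝ → ℝ}

/-- Positive homogeneity alone determines `H` from its values at `±1`, and `H 0 = 2 H 0` gives `H 0
= 0`. -/
lemma IsAnisotropy.eq_Hab {H : ℝ → ℝ} (h : IsAnisotropy H) : H = Hab (H 1) (H (-1)) := by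
  have h0 : H 0 = 0 := by
    have := h.homog 2 0 two_pos
    rw [mul_zero] at this; linarith
  ext t
  rcases lt_trichotomy t 0 with ht | ht | ht
  · rw [Hab_of_neg _ _ ht.le]
    have := h.homog (-t) (-1) (by linarith)
    rw [show -t * -1 = t by ring] at this
    rw [this]; ring
  · rw [ht, h0]; simp [Hab]
  · rw [Hab_of_pos _ _ ht.le]
    have := h.homog t 1 ht
    rw [mul_one] at this
    rw [this]; ring

lemma isAnisotropy_Hab (ha : 0 ≤ a) (hb : 0 ≤ b) : IsAnisotropy (Hab a b) := by
  refine ⟨Hab_nonneg ha hb, ?_, fun t x ht => ?_⟩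
  · have h1 : ConvexOn ℝ univ fun t : ℝ => max t 0 :=
      (convexOn_id convex_univ).sup (convexOn_const 0 convex_univ)
    have h2 : ConvexOn ℝ univ fun t : ℝ => max (-t) 0 :=
      (concaveOn_id convex_univ).neg.sup (convexOn_const 0 convex_univ)
    exact (h1.smul ha).add (h2.smul hb)
  · rcases le_total 0 x with hx | hx
    · rw [Hab_of_pos a b hx, Hab_of_pos a b (by positivity)]; ring
    · rw [Hab_of_neg a b hx, Hab_of_neg a b (by nlinarith)]; ring

@[simp] lemma Hab_one (a b : ℝ) : Hab a b 1 = a := by simp [Hab]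

@[simp] lemma Hab_neg_one (a b : ℝ) : Hab a b (-1) = b := by simp [Hab]

lemma anisoNorm_Hab (a b : ℝ) : anisoNorm (Hab a b) = max a b := by
  have h : Metric.sphere (0 : ℝ) 1 = {1, -1} := by
    ext x
    simp [Real.norm_eq_abs, abs_eq]
  rw [anisoNorm, h, image_pair, Hab_one, Hab_neg_one, csSup_pair]

lemma Hab_one_one : Hab 1 1 = fun t => |t| := by
  ext t
  rcases le_total 0 t with h | h
  · rw [Hab_of_pos _ _ h, abs_of_nonneg h, one_mul]
  · rw [Hab_of_neg _ _ h, abs_of_nonpos h, one_mul]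

/-- The frequency is linear in `a + b`, and the level is proportional to its `p`-th power. -/
lemma gsLevel_eq (hL : 0 < L) (hT : 0 < T) (ha : 0 ≤ a) (hb : 0 ≤ b) :
    gsLevel p L T a b = ((a + b) / 2) ^ p * gsLevel p L T 1 1 := by
  have h1 : gsFreq L T a b = (a + b) / 2 * gsFreq L T 1 1 := by unfold gsFreq; field_simp; ring
  have h2 : 0 < gsFreq L T 1 1 := gsFreq_pos hL hT one_pos one_pos
  rw [gsLevel, gsLevel, h1, Real.mul_rpow (by positivity) h2.le]
  ring

lemma IsPSine.lambda1p_eq (hw : IsPSine p L w) (hp : 1 < p) (hT : 0 < T) :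
    lambda1p (Ioo (-T) T) p = gsLevel p L T 1 1 := by
  rw [lambda1p, ← Hab_one_one, hw.level_Hab hp hT zero_le_one zero_le_one]

/-- The least energy level of `H_{a,b}` in terms of the first eigenvalue of the `p`-Laplacian. -/
lemma level_Hab_eq (hp : 1 < p) (hT : 0 < T) (ha : 0 ≤ a) (hb : 0 ≤ b) :
    level (Ioo (-T) T) p (Hab a b) = ((a + b) / 2) ^ p * lambda1p (Ioo (-T) T) p := by
  obtain ⟨L, w, hw⟩ := exists_isPSine hp
  rw [hw.level_Hab hp hT ha hb, hw.lambda1p_eq hp hT, gsLevel_eq hw.pos hT ha hb]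

lemma lambda1p_pos (hp : 1 < p) (hT : 0 < T) : 0 < lambda1p (Ioo (-T) T) p := by
  obtain ⟨L, w, hw⟩ := exists_isPSine hp
  rw [hw.lambda1p_eq hp hT]
  exact gsLevel_pos hp hw.pos hT (by norm_num)

/-- The gradient of an asymmetric tent function. -/
def tentGrad (T t : ℝ) : ℝ := (Iio (-T / 3)).indicator (fun _ => (3 : ℝ)) t - 1

lemma integrable_indicator_Iio (c : ℝ) :
    Integrable ((Iio (-T / 3)).indicator fun _ : ℝ => c) (volume.restrict (Ioo (-T) T)) :=
  (integrable_const c).indicator measurableSet_Iio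

lemma integral_indicator_Iio (hT : 0 < T) (c : ℝ) :
    ∫ t in Ioo (-T) T, (Iio (-T / 3)).indicator (fun _ : ℝ => c) t = 2 * T / 3 * c := by
  have h : Iio (-T / 3) ∩ Ioo (-T) T = Ioo (-T) (-T / 3) := by
    ext t
    simp only [mem_inter_iff, mem_Iio, mem_Ioo]
    constructor
    · rintro ⟨h1, h2, h3⟩; exact ⟨h2, h1⟩
    · rintro ⟨h1, h2⟩; exact ⟨h2, h1, by linarith⟩
  rw [integral_indicator measurableSet_Iio, setIntegral_const, Measure.real,
    Measure.restrict_apply measurableSet_Iio, h, Real.volume_Ioo,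
    ENNReal.toReal_ofReal (by linarith), smul_eq_mul]
  ring

lemma integral_const_Ioo (hT : 0 < T) (c : ℝ) : ∫ _ in Ioo (-T) T, c = 2 * T * c := by
  rw [setIntegral_const, Measure.real, Real.volume_Ioo, ENNReal.toReal_ofReal (by linarith),
    smul_eq_mul]
  ring

lemma integral_tentGrad (hT : 0 < T) : ∫ t in Ioo (-T) T, tentGrad T t = 0 := by
  unfold tentGrad
  rw [integral_sub (integrable_indicator_Iio 3) (integrable_const 1), integral_indicator_Iio hT,
    integral_const_Ioo hT]
  ring

lemma max_tentGrad_rpow (hp : p ≠ 0) (t : ℝ) :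
    max (tentGrad T t) 0 ^ p = (Iio (-T / 3)).indicator (fun _ => (2 : ℝ) ^ p) t := by
  unfold tentGrad
  by_cases ht : t ∈ Iio (-T / 3)
  · rw [indicator_of_mem ht, indicator_of_mem ht, max_eq_left (by norm_num)]
    congr 1; norm_num
  · rw [indicator_of_notMem ht, indicator_of_notMem ht, max_eq_right (by norm_num),
      Real.zero_rpow hp]

lemma max_neg_tentGrad_rpow (hp : p ≠ 0) (t : ℝ) :
    max (-tentGrad T t) 0 ^ p = 1 - (Iio (-T / 3)).indicator (fun _ => (1 : ℝ)) t := by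
  unfold tentGrad
  by_cases ht : t ∈ Iio (-T / 3)
  · rw [indicator_of_mem ht, indicator_of_mem ht, max_eq_right (by norm_num), Real.zero_rpow hp,
      sub_self]
  · rw [indicator_of_notMem ht, indicator_of_notMem ht, max_eq_left (by norm_num), zero_sub,
      neg_neg, Real.one_rpow, sub_zero]

lemma memLp_tentGrad (q : ENNReal) :
    MemLp (tentGrad T) q (volume.restrict (Ioo (-T) T)) := by
  have h1 : MemLp ((Iio (-T / 3)).indicator fun _ : ℝ => (3 : ℝ)) q
      (volume.restrict (Ioo (-T) T)) := (memLp_const 3).indicator measurableSet_Iio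
  exact h1.sub (memLp_const 1)

/-- The tent has slope `2` on a third of the interval and `-1` on the rest. The two energies are in
the ratio `2^p : 2`, so they differ because `p > 1`; `v` is `-u`. -/
lemma exists_W0_energies (hp : 1 < p) (hT : 0 < T) :
    ∃ u v : W0 (Ioo (-T) T) p, 0 < u.posEnergy ∧ 0 < u.negEnergy ∧
      u.posEnergy ≠ u.negEnergy ∧ v.posEnergy = u.negEnergy ∧ v.negEnergy = u.posEnergy := by
  have hp0 : p ≠ 0 := by linarith
  have h0 : ∫ t in (-T)..T, tentGrad T t = 0 := by
    rw [intervalIntegral_eq_setIntegral_Ioo (by linarith), integral_tentGrad hT]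
  obtain ⟨u, hu, -⟩ := exists_W0_of_grad hp hT (memLp_tentGrad _) h0
  obtain ⟨v, hv, -⟩ := u.exists_smul hp hT (-1)
  have hpos : u.posEnergy = 2 * T / 3 * 2 ^ p := by
    simp only [W0.posEnergy, hu, max_tentGrad_rpow hp0, integral_indicator_Iio hT]
  have hneg : u.negEnergy = 4 * T / 3 := by
    simp only [W0.negEnergy, hu, max_neg_tentGrad_rpow hp0]
    rw [integral_sub (integrable_const 1) (integrable_indicator_Iio 1), integral_indicator_Iio hT,
      integral_const_Ioo hT]
    ring
  have h2p : (2 : ℝ) < 2 ^ p := by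
    simpa using Real.rpow_lt_rpow_of_exponent_lt (by norm_num : (1 : ℝ) < 2) hp
  refine ⟨u, v, ?_, ?_, ?_, ?_, ?_⟩
  · rw [hpos]; positivity
  · rw [hneg]; positivity
  · rw [hpos, hneg]; exact ne_of_gt (by nlinarith)
  · simp only [W0.posEnergy, W0.negEnergy, hv, neg_one_mul]
  · simp only [W0.posEnergy, W0.negEnergy, hv, neg_one_mul, neg_neg]

/-- The diagonal values of the operator at `u` and `-u` are two linear equations for `a^p` and
`b^p`, with determinant `A^2 - B^2 ≠ 0`. -/
lemma negLap_Hab_injective (hp : 1 < p) (hT : 0 < T) {a' b' : ℝ} (ha : 0 ≤ a) (hb : 0 ≤ b)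
    (ha' : 0 ≤ a') (hb' : 0 ≤ b')
    (h : negLap (Ioo (-T) T) p (Hab a b) = negLap (Ioo (-T) T) p (Hab a' b')) :
    a = a' ∧ b = b' := by
  obtain ⟨u, v, hA, hB, hAB, h1, h2⟩ := exists_W0_energies hp hT
  have eu := congrFun (congrFun h u) u
  have ev := congrFun (congrFun h v) v
  rw [negLap_Hab_self hp ha hb, negLap_Hab_self hp ha' hb', energy_Hab hp ha hb,
    energy_Hab hp ha' hb'] at eu ev
  rw [h1, h2] at ev
  set A := u.posEnergy
  set B := u.negEnergy
  have hd : A ^ 2 - B ^ 2 ≠ 0 := by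
    rw [sq_sub_sq]
    exact mul_ne_zero (by positivity) (sub_ne_zero.2 hAB)
  have e1 : a ^ p = a' ^ p := mul_right_cancel₀ hd (by linear_combination A * eu - B * ev)
  have e2 : b ^ p = b' ^ p := mul_right_cancel₀ hd (by linear_combination A * ev - B * eu)
  have hp0 : p ≠ 0 := by linarith
  exact ⟨(Real.rpow_left_inj ha ha' hp0).1 e1, (Real.rpow_left_inj hb hb' hp0).1 e2⟩

/-- Membership only provides some anisotropy generating the same operator. Injectivity identifies it
with `H_{a,b}`, so that the non-existence results apply. -/
lemma negLap_Hab_mem_EllClass (hp : 1 < p) (hT : 0 < T) (ha : 0 ≤ a) (hb : 0 ≤ b) :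
    negLap (Ioo (-T) T) p (Hab a b) ∈ EllClass (Ioo (-T) T) p ↔ 0 < a ∧ 0 < b := by
  obtain ⟨L, w, hw⟩ := exists_isPSine hp
  constructor
  · rintro ⟨H, hH, hH0, hf, heq⟩
    rw [hH.eq_Hab] at heq hf
    obtain ⟨e1, e2⟩ := negLap_Hab_injective hp hT ha hb (hH.nonneg 1) (hH.nonneg (-1)) heq
    rw [← e1, ← e2] at hf
    have h0 : ¬ (a = 0 ∧ b = 0) := by
      rintro ⟨rfl, rfl⟩
      refine hH0 ?_
      rw [hH.eq_Hab, ← e1, ← e2]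
      ext t; simp [Hab]
    rcases ha.eq_or_lt with h | h
    · subst h
      exact absurd hf (hw.not_isFundamentalFrequency_right hp hT
        (lt_of_le_of_ne hb fun h => h0 ⟨rfl, h.symm⟩))
    rcases hb.eq_or_lt with h' | h'
    · subst h'
      exact absurd hf (hw.not_isFundamentalFrequency_left hp hT h)
    exact ⟨h, h'⟩
  · rintro ⟨ha, hb⟩
    refine ⟨_, isAnisotropy_Hab ha.le hb.le, fun h => ?_,
      hw.isFundamentalFrequency hp hT ha hb, rfl⟩
    have := congrFun h 1
    rw [Hab_one] at this
    exact ha.ne' this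

lemma mem_normalizedLevels (hp : 1 < p) (hT : 0 < T) {l : ℝ} :
    l ∈ normalizedLevels (Ioo (-T) T) p ↔ ∃ a b : ℝ, 0 < a ∧ 0 < b ∧ max a b = 1 ∧
      l = ((a + b) / 2) ^ p * lambda1p (Ioo (-T) T) p := by
  constructor
  · rintro ⟨H, hH, hm, hn, rfl⟩
    rw [hH.eq_Hab] at hm hn
    rw [negLap_Hab_mem_EllClass hp hT (hH.nonneg _) (hH.nonneg _)] at hm
    rw [anisoNorm_Hab] at hn
    refine ⟨H 1, H (-1), hm.1, hm.2, hn, ?_⟩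
    rw [← level_Hab_eq hp hT (hH.nonneg _) (hH.nonneg _), ← hH.eq_Hab]
  · rintro ⟨a, b, ha, hb, hm, rfl⟩
    exact ⟨Hab a b, isAnisotropy_Hab ha.le hb.le,
      (negLap_Hab_mem_EllClass hp hT ha.le hb.le).2 ⟨ha, hb⟩, by rw [anisoNorm_Hab, hm],
      (level_Hab_eq hp hT ha.le hb.le).symm⟩

lemma isGreatest_normalizedLevels (hp : 1 < p) (hT : 0 < T) :
    IsGreatest (normalizedLevels (Ioo (-T) T) p) (lambda1p (Ioo (-T) T) p) := by
  have hΛ := lambda1p_pos hp hT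
  refine ⟨(mem_normalizedLevels hp hT).2 ⟨1, 1, one_pos, one_pos, max_self 1, by norm_num⟩, ?_⟩
  rintro l hl
  obtain ⟨a, b, ha, hb, hm, rfl⟩ := (mem_normalizedLevels hp hT).1 hl
  have h1 : a ≤ 1 := hm ▸ le_max_left a b
  have h2 : b ≤ 1 := hm ▸ le_max_right a b
  exact mul_le_of_le_one_left hΛ.le
    (Real.rpow_le_one (by positivity) (by linarith) (by linarith))

/-- When `max a b = 1` one has `a + b ≥ 1`, and the bound is approached along `(1, e)` as `e`
decreases to `0`; the limit `(1, 0)` lies outside the class. -/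
lemma isGLB_normalizedLevels (hp : 1 < p) (hT : 0 < T) :
    IsGLB (normalizedLevels (Ioo (-T) T) p) (1 / 2 ^ p * lambda1p (Ioo (-T) T) p) := by
  have hΛ := lambda1p_pos hp hT
  constructor
  · rintro l hl
    obtain ⟨a, b, ha, hb, hm, rfl⟩ := (mem_normalizedLevels hp hT).1 hl
    have h1 : 1 ≤ a + b := by rcases max_choice a b with h | h <;> linarith
    rw [Real.div_rpow (by positivity) zero_le_two]
    have := Real.one_le_rpow h1 (by linarith : 0 ≤ p)
    gcongr
  · intro l hl
    have hc : Continuous fun e : ℝ => ((1 + e) / 2) ^ p * lambda1p (Ioo (-T) T) p :=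
      ((by fun_prop : Continuous fun e : ℝ => (1 + e) / 2).rpow_const fun _ =>
        Or.inr (by linarith)).mul continuous_const
    have h := ge_of_tendsto (b := l) (hc.continuousWithinAt (s := Ioi 0) (x := 0)).tendsto (by
      filter_upwards [Ioo_mem_nhdsGT (zero_lt_one (α := ℝ))] with e he
      exact hl ((mem_normalizedLevels hp hT).2
        ⟨1, e, one_pos, he.1, max_eq_left he.2.le, rfl⟩))
    rwa [add_zero, Real.div_rpow zero_le_one zero_le_two, Real.one_rpow] at h

lemma LambdaMax_eq (hp : 1 < p) (hT : 0 < T) :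
    LambdaMax (Ioo (-T) T) p = lambda1p (Ioo (-T) T) p :=
  (isGreatest_normalizedLevels hp hT).csSup_eq

lemma LambdaMin_eq (hp : 1 < p) (hT : 0 < T) :
    LambdaMin (Ioo (-T) T) p = 1 / 2 ^ p * lambda1p (Ioo (-T) T) p :=
  (isGLB_normalizedLevels hp hT).csInf_eq (isGreatest_normalizedLevels hp hT).nonempty

lemma negLap_Hab_diag (hp : 1 < p) (ha : 0 ≤ a) :
    negLap (Ioo (-T) T) p (Hab a a) = a ^ p • negPLap (Ioo (-T) T) p := by
  funext u φ
  rw [Pi.smul_apply, Pi.smul_apply, negPLap, ← Hab_one_one, negLap, negLap, smul_eq_mul,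
    ← integral_const_mul]
  congr 1; funext t
  rw [Hab_flux hp ha ha, Hab_flux hp zero_le_one zero_le_one, Real.one_rpow]
  ring

/-- The operator is `p`-homogeneous in `H`, so a factor `c` on it is a factor `c^{1/p}` on the
absolute value. -/
lemma smul_negPLap_eq (hp : 1 < p) {c : ℝ} (hc : 0 ≤ c) :
    c • negPLap (Ioo (-T) T) p = negLap (Ioo (-T) T) p (Hab (c ^ (1 / p)) (c ^ (1 / p))) := by
  rw [negLap_Hab_diag hp (Real.rpow_nonneg hc _), ← Real.rpow_mul hc,
    one_div_mul_cancel (by linarith), Real.rpow_one]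

/-- Equality on the right of the two-sided estimate. -/
lemma level_eq_LambdaMax_iff (hp : 1 < p) (hT : 0 < T) (ha : 0 ≤ a) (hb : 0 ≤ b) :
    level (Ioo (-T) T) p (Hab a b) = LambdaMax (Ioo (-T) T) p * max a b ^ p ↔ a = b := by
  have hp0 : p ≠ 0 := by linarith
  rw [level_Hab_eq hp hT ha hb, LambdaMax_eq hp hT, mul_comm (lambda1p _ _),
    mul_left_inj' (lambda1p_pos hp hT).ne',
    Real.rpow_left_inj (by positivity) (le_max_of_le_left ha) hp0]
  rcases le_total a b with h | h
  · rw [max_eq_right h]; constructor <;> intro h <;> linarith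
  · rw [max_eq_left h]; constructor <;> intro h <;> linarith

/-- Equality on the left of the two-sided estimate. -/
lemma level_eq_LambdaMin_iff (hp : 1 < p) (hT : 0 < T) (ha : 0 ≤ a) (hb : 0 ≤ b) :
    level (Ioo (-T) T) p (Hab a b) = LambdaMin (Ioo (-T) T) p * max a b ^ p ↔
      a = 0 ∨ b = 0 := by
  have hp0 : p ≠ 0 := by linarith
  have hm : 0 ≤ max a b := le_max_of_le_left ha
  have h2 : 1 / 2 ^ p * lambda1p (Ioo (-T) T) p * max a b ^ p =
      (max a b / 2) ^ p * lambda1p (Ioo (-T) T) p := by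
    rw [Real.div_rpow hm zero_le_two]; ring
  rw [level_Hab_eq hp hT ha hb, LambdaMin_eq hp hT, h2,
    mul_left_inj' (lambda1p_pos hp hT).ne',
    Real.rpow_left_inj (by positivity) (by positivity) hp0]
  rcases le_total a b with h | h
  · rw [max_eq_right h]
    constructor
    · intro h; left; linarith
    · rintro (h | h) <;> linarith
  · rw [max_eq_left h]
    constructor
    · intro h; right; linarith
    · rintro (h | h) <;> linarith

lemma level_bounds (hp : 1 < p) (hT : 0 < T) (ha : 0 ≤ a) (hb : 0 ≤ b) :
    LambdaMin (Ioo (-T) T) p * max a b ^ p ≤ level (Ioo (-T) T) p (Hab a b) ∧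
      level (Ioo (-T) T) p (Hab a b) ≤ LambdaMax (Ioo (-T) T) p * max a b ^ p := by
  have hm : 0 ≤ max a b := le_max_of_le_left ha
  have hΛ := lambda1p_pos hp hT
  have h2 : 1 / 2 ^ p * lambda1p (Ioo (-T) T) p * max a b ^ p =
      (max a b / 2) ^ p * lambda1p (Ioo (-T) T) p := by
    rw [Real.div_rpow hm zero_le_two]; ring
  rw [level_Hab_eq hp hT ha hb, LambdaMin_eq hp hT, LambdaMax_eq hp hT, h2,
    mul_comm (lambda1p _ _)]
  have h3 : max a b ≤ a + b := max_le (by linarith) (by linarith)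
  have h4 : (a + b) / 2 ≤ max a b := by linarith [le_max_left a b, le_max_right a b]
  constructor <;> gcongr

/-- Pairing both operators with a function `u` whose two energies are positive gives a number that
is at once `≥ 0` and `≤ 0`. Hence `H` vanishes at `±1`, and so everywhere. -/
lemma negLap_ne_smul_negPLap (hp : 1 < p) (hT : 0 < T) {c : ℝ} (hc : c ≤ 0) {H : ℝ → ℝ}
    (hH : IsAnisotropy H) (hH0 : H ≠ 0) :
    negLap (Ioo (-T) T) p H ≠ c • negPLap (Ioo (-T) T) p := by
  intro heq
  have ha := hH.nonneg 1
  have hb := hH.nonneg (-1)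
  obtain ⟨u, -, hA, hB, -⟩ := exists_W0_energies hp hT
  have h1 := congrFun (congrFun heq u) u
  rw [Pi.smul_apply, Pi.smul_apply, negPLap, ← Hab_one_one, hH.eq_Hab,
    negLap_Hab_self hp ha hb, negLap_Hab_self hp zero_le_one zero_le_one, energy_Hab hp ha hb,
    energy_Hab hp zero_le_one zero_le_one, Real.one_rpow, smul_eq_mul] at h1
  have h2 : c * (1 * u.posEnergy + 1 * u.negEnergy) ≤ 0 :=
    mul_nonpos_of_nonpos_of_nonneg hc (by linarith)
  have h3 : 0 ≤ H 1 ^ p * u.posEnergy := by positivity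
  have h4 : 0 ≤ H (-1) ^ p * u.negEnergy := by positivity
  have h5 : H 1 ^ p = 0 := (mul_eq_zero.1 (by linarith : H 1 ^ p * u.posEnergy = 0)).resolve_right
    hA.ne'
  have h6 : H (-1) ^ p = 0 :=
    (mul_eq_zero.1 (by linarith : H (-1) ^ p * u.negEnergy = 0)).resolve_right hB.ne'
  rw [Real.rpow_eq_zero ha (by linarith)] at h5
  rw [Real.rpow_eq_zero hb (by linarith)] at h6
  refine hH0 ?_
  rw [hH.eq_Hab, h5, h6]
  ext t; simp [Hab]

end Class

end

theorem corollary1p2 (p T : ℝ) (hp : 1 < p) (hT : 0 < T) :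
    -- the two-sided estimate on the class of operators
    (∀ a b : ℝ, 0 ≤ a → 0 ≤ b → negLap (Ioo (-T) T) p (Hab a b) ∈ EllClass (Ioo (-T) T) p →
      LambdaMin (Ioo (-T) T) p * (max a b) ^ p ≤ level (Ioo (-T) T) p (Hab a b) ∧
      level (Ioo (-T) T) p (Hab a b) ≤ LambdaMax (Ioo (-T) T) p * (max a b) ^ p) ∧
    -- the optimal constants, which are a genuine supremum and a genuine infimum
    (normalizedLevels (Ioo (-T) T) p).Nonempty ∧
    IsLUB (normalizedLevels (Ioo (-T) T) p) (LambdaMax (Ioo (-T) T) p) ∧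
    IsGLB (normalizedLevels (Ioo (-T) T) p) (LambdaMin (Ioo (-T) T) p) ∧
    LambdaMax (Ioo (-T) T) p = lambda1p (Ioo (-T) T) p ∧
    LambdaMin (Ioo (-T) T) p = 1 / 2 ^ p * lambda1p (Ioo (-T) T) p ∧
    -- the extremal operators on the right are the positive multiples of the `p`-Laplacian
    {L : WeakOperator (Ioo (-T) T) p | ∃ a b : ℝ, 0 ≤ a ∧ 0 ≤ b ∧ (0 < a ∨ 0 < b) ∧
        L = negLap (Ioo (-T) T) p (Hab a b) ∧
        level (Ioo (-T) T) p (Hab a b) = LambdaMax (Ioo (-T) T) p * (max a b) ^ p} =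
      {L | ∃ c : ℝ, 0 < c ∧ L = c • negPLap (Ioo (-T) T) p} ∧
    (∀ c : ℝ, 0 < c → c • negPLap (Ioo (-T) T) p ∈ EllClass (Ioo (-T) T) p) ∧
    -- non-positive multiples are not operators generated by a non-zero anisotropy
    (∀ c : ℝ, c ≤ 0 → ∀ H : ℝ → ℝ, IsAnisotropy H → H ≠ 0 →
      negLap (Ioo (-T) T) p H ≠ c • negPLap (Ioo (-T) T) p) ∧
    -- the extremal operators on the left are the two degenerate families, outside the class
    {L : WeakOperator (Ioo (-T) T) p | ∃ a b : ℝ, 0 ≤ a ∧ 0 ≤ b ∧ (0 < a ∨ 0 < b) ∧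
        L = negLap (Ioo (-T) T) p (Hab a b) ∧
        level (Ioo (-T) T) p (Hab a b) = LambdaMin (Ioo (-T) T) p * (max a b) ^ p} =
      {L | ∃ a : ℝ, 0 < a ∧ L = negLap (Ioo (-T) T) p (Hab a 0)} ∪
      {L | ∃ b : ℝ, 0 < b ∧ L = negLap (Ioo (-T) T) p (Hab 0 b)} ∧
    (∀ a : ℝ, 0 < a → negLap (Ioo (-T) T) p (Hab a 0) ∉ EllClass (Ioo (-T) T) p) ∧
    (∀ b : ℝ, 0 < b → negLap (Ioo (-T) T) p (Hab 0 b) ∉ EllClass (Ioo (-T) T) p) := by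
  refine ⟨fun a b ha hb _ => level_bounds hp hT ha hb,
    (isGreatest_normalizedLevels hp hT).nonempty, ?_, ?_, LambdaMax_eq hp hT, LambdaMin_eq hp hT,
    ?_, fun c hc => ?_, fun c hc H hH hH0 => negLap_ne_smul_negPLap hp hT hc hH hH0, ?_,
    fun a ha h => ?_, fun b hb h => ?_⟩
  · rw [LambdaMax_eq hp hT]; exact (isGreatest_normalizedLevels hp hT).isLUB
  · rw [LambdaMin_eq hp hT]; exact isGLB_normalizedLevels hp hT
  · ext L
    constructor
    · rintro ⟨a, b, ha, hb, hab, rfl, h⟩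
      obtain rfl := (level_eq_LambdaMax_iff hp hT ha hb).1 h
      exact ⟨a ^ p, Real.rpow_pos_of_pos (or_self_iff.1 hab) p, negLap_Hab_diag hp ha⟩
    · rintro ⟨c, hc, rfl⟩
      have hc' : 0 < c ^ (1 / p) := Real.rpow_pos_of_pos hc _
      exact ⟨c ^ (1 / p), c ^ (1 / p), hc'.le, hc'.le, Or.inl hc', smul_negPLap_eq hp hc.le,
        (level_eq_LambdaMax_iff hp hT hc'.le hc'.le).2 rfl⟩
  · have hc' : 0 < c ^ (1 / p) := Real.rpow_pos_of_pos hc _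
    rw [smul_negPLap_eq hp hc.le, negLap_Hab_mem_EllClass hp hT hc'.le hc'.le]
    exact ⟨hc', hc'⟩
  · ext L
    constructor
    · rintro ⟨a, b, ha, hb, hab, rfl, h⟩
      rcases (level_eq_LambdaMin_iff hp hT ha hb).1 h with rfl | rfl
      · exact Or.inr ⟨b, hab.resolve_left (lt_irrefl 0), rfl⟩
      · exact Or.inl ⟨a, hab.resolve_right (lt_irrefl 0), rfl⟩
    · rintro (⟨a, ha, rfl⟩ | ⟨b, hb, rfl⟩)
      · exact ⟨a, 0, ha.le, le_rfl, Or.inl ha, rfl,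
          (level_eq_LambdaMin_iff hp hT ha.le le_rfl).2 (Or.inr rfl)⟩
      · exact ⟨0, b, le_rfl, hb.le, Or.inr hb, rfl,
          (level_eq_LambdaMin_iff hp hT le_rfl hb.le).2 (Or.inl rfl)⟩
  · exact lt_irrefl 0 ((negLap_Hab_mem_EllClass hp hT ha.le le_rfl).1 h).2
  · exact lt_irrefl 0 ((negLap_Hab_mem_EllClass hp hT le_rfl hb.le).1 h).1
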